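/- Let $\mathbb{K}$ be an algebraically closed field of characteristic zero. For a finite-dimensional local $\mathbb{K}$-algebra $(\mathcal{A},\mathfrak{n})$ let $H_{\mathcal{A}}(i)=\dim_{\mathbb{K}}\mathfrak{n}^i/\mathfrak{n}^{i+1}$ be its Hilbert function, and let its socle degree be the largest $s$ with $\mathfrak{n}^s\neq 0$. Let $R=\mathbb{K}[\alpha_1,\dots,\alpha_n]\subset\hat R=\mathbb{K}[[\alpha_1,\dots,\alpha_n]]$, let $\pi_i:\hat R\to\mathbb{K}[[\alpha_i]]$ be the projection with $\pi_i(\alpha_i)=\alpha_i$ and $\pi_i(\alpha_j)=0$ for $j\ne i$, and let $\mathfrak{p}_i=\ker\pi_i$. For an ideal $I\subset\hat R$ of finite colength, a ray decomposition of $I$ with respect to $\alpha_i$ is an equality $I=J+(\alpha_i^\nu-q)\hat R$ with an ideal $J\subset I\cap\mathfrak{p}_i$, $q\in R\cap\mathfrak{p}_i$ and $\nu\in\mathbb{N}$. For $\nu\geq 1$ its upper ray family is $$\mathbb{K}[t]\to\mathcal{F}=\frac{R[t]}{(J\cap R)[t]+(\alpha_i^{\nu}-t\alpha_i^{\nu-1}-q)R[t]},$$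 and it is called an upper ray degeneration if it is flat. **Theorem.** Let $c\ge 0$ and $s\geq\max(1,2c)$ be integers and let $\mathcal{A}$ be a finite-dimensional local $\mathbb{K}$-algebra of socle degree $s$ with Hilbert function $(1,H_1,\dots,H_c,1,\dots,1)$, that is, $H_{\mathcal{A}}(j)=1$ for $c<j\le s$. Put $n=H_{\mathcal{A}}(1)$, and assume that the Hilbert function is not $(1,n,1)$ with $n\ge 2$. Then there are an ideal $I\subset\hat R=\mathbb{K}[[\alpha_1,\dots,\alpha_n]]$ with $\mathcal{A}\cong\hat R/I$, an index $i$, and a ray decomposition $I=J+(\alpha_i^\nu-q)\hat R$ with $J=I\cap\mathfrak{p}_i$, $\nu\ge 1$ and $\pi_i(I)=(\alpha_i^\nu)$, whose upper ray family $\mathcal{F}$ is flat and finite over $\mathbb{K}[t]$ and satisfies: * the fibre $\mathcal{F}/t\mathcal{F}$ is isomorphic to $\mathcal{A}$; * for every $\lambda\in\mathbb{K}\setminus\{0\}$ there is an isomorphism of $\mathbb{K}$-algebras $\mathcal{F}/(t-\lambda)\mathcal{F}\cong\mathbb{K}\times\mathcal{B}_\lambda$, where $\mathcal{B}_\lambda$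 is a finite-dimensional local $\mathbb{K}$-algebra of socle degree $s-1$ with $H_{\mathcal{B}_\lambda}(j)=H_{\mathcal{A}}(j)$ for all $j\le s-1$ (the same Hilbert function with one final $1$ less). Under this isomorphism the point $\operatorname{Spec}\mathbb{K}$ is the point with $\alpha_i=\lambda$ and $\alpha_j=0$ for $j\neq i$, and the images of all $\alpha_j$ in $\mathcal{B}_\lambda$ lie in its maximal ideal (so $\operatorname{Spec}\mathcal{B}_\lambda$ is supported at the origin). In particular, $\operatorname{Spec}\mathcal{A}$ is a flat limit of disjoint unions of a point and the spectrum of a local algebra with the Hilbert function shortened by one $1$. -/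

import Mathlib

universe u v

noncomputable section

namespace RayDegeneration

open IsLocalRing

/-- The Hilbert function `i ↦ dim_K 𝔫^i / 𝔫^(i+1)` of a local `K`-algebra `(A, 𝔫)`.
(It is used only for algebras that are finite-dimensional over `K`.) -/
def hilbertFunction (K : Type u) (A : Type v) [Field K] [CommRing A] [IsLocalRing A]
    [Algebra K A] (i : ℕ) : ℕ :=
  Module.finrank K
    (↥(maximalIdeal A ^ i) ⧸ (maximalIdeal A ^ (i + 1)).submoduleOf (maximalIdeal A ^ i))

/-- `s` is the socle degree of the local ring `(A, 𝔫)`: the largest integer with `𝔫^s ≠ 0`. -/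
def IsSocleDegree (A : Type v) [CommRing A] [IsLocalRing A] (s : ℕ) : Prop :=
  IsGreatest {k : ℕ | maximalIdeal A ^ k ≠ ⊥} s

section Ray

variable {K : Type u} [Field K] {n : ℕ}

/-- The projection `π_i : K⟦α_1, …, α_n⟧ → K⟦α_i⟧` with `π_i(α_j) = 0` for `j ≠ i` and
`π_i(α_i) = α_i`. -/
def rayProj (K : Type u) [Field K] {n : ℕ} (i : Fin n) :
    MvPowerSeries (Fin n) K →ₐ[K] PowerSeries K :=
  MvPowerSeries.killCompl ⟨fun _ : Unit => i, Function.injective_of_subsingleton _⟩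

/-- The kernel `𝔭_i` of `π_i`. -/
def rayIdeal (K : Type u) [Field K] {n : ℕ} (i : Fin n) : Ideal (MvPowerSeries (Fin n) K) :=
  RingHom.ker (rayProj K i)

/-- `ν` is the `i`-th ray order of `I`: `π_i(I) = (α_i^ν)`. -/
def IsRayOrder (I : Ideal (MvPowerSeries (Fin n) K)) (i : Fin n) (ν : ℕ) : Prop :=
  I.map (rayProj K i) = Ideal.span {(PowerSeries.X : PowerSeries K) ^ ν}

/-- A ray decomposition `I = J + (α_i^ν - q)` of `I` with respect to `α_i`, where
`J ⊆ I ∩ 𝔭_i` and where `q ∈ 𝔭_i` is a polynomial. -/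
structure RayDecomposition (I : Ideal (MvPowerSeries (Fin n) K)) (i : Fin n) where
  J : Ideal (MvPowerSeries (Fin n) K)
  q : MvPolynomial (Fin n) K
  ν : ℕ
  J_le : J ≤ I ⊓ rayIdeal K i
  q_mem : (q : MvPowerSeries (Fin n) K) ∈ rayIdeal K i
  eq_sup : I = J ⊔ Ideal.span {MvPowerSeries.X i ^ ν - (q : MvPowerSeries (Fin n) K)}

namespace RayDecomposition

variable {I : Ideal (MvPowerSeries (Fin n) K)} {i : Fin n}

/-- The contraction `J_R = J ∩ R` to the polynomial ring `R = K[α_1, …, α_n]`. -/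
def polyJ (D : RayDecomposition I i) : Ideal (MvPolynomial (Fin n) K) :=
  D.J.comap MvPolynomial.coeToMvPowerSeries.ringHom

/-- The ideal `J_R[t] + (α_i^ν - t α_i^(ν-1) - q)` of `R[t]`, where `R[t]` is realised as
`K[t][α_1, …, α_n]`. It is meant for `ν ≥ 1`, i.e. for proper ideals `I`. -/
def upperRayIdeal (D : RayDecomposition I i) : Ideal (MvPolynomial (Fin n) (Polynomial K)) :=
  D.polyJ.map (MvPolynomial.map (Polynomial.C : K →+* Polynomial K)) ⊔
    Ideal.span {MvPolynomial.X i ^ D.ν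
      - MvPolynomial.C Polynomial.X * MvPolynomial.X i ^ (D.ν - 1)
      - MvPolynomial.map Polynomial.C D.q}

/-- The upper ray family `K[t] → R[t] / (J_R[t] + (α_i^ν - t α_i^(ν-1) - q))`. -/
abbrev UpperRayFamily (D : RayDecomposition I i) : Type u :=
  MvPolynomial (Fin n) (Polynomial K) ⧸ D.upperRayIdeal

/-- The upper ray family is an upper ray degeneration when it is flat over `K[t]`. -/
def IsUpperRayDegeneration (D : RayDecomposition I i) : Prop :=
  Module.Flat (Polynomial K) D.UpperRayFamily

end RayDecomposition

end Ray

/-- The fibre `F / (t - a) F` of a family `K[t] → F` over the point `t = a`. -/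
abbrev Fibre {K : Type u} [Field K] (F : Type v) [CommRing F] [Algebra (Polynomial K) F]
    (a : K) : Type v :=
  F ⧸ Ideal.span {algebraMap (Polynomial K) F (Polynomial.X - Polynomial.C a)}

/-- The class of the coordinate `α_j` in the fibre of the upper ray family over `t = a`. -/
def fibreCoord {K : Type u} [Field K] {n : ℕ} {I : Ideal (MvPowerSeries (Fin n) K)} {i : Fin n}
    (D : RayDecomposition I i) (a : K) (j : Fin n) : Fibre D.UpperRayFamily a :=
  Ideal.Quotient.mk _ (Ideal.Quotient.mk D.upperRayIdeal (MvPolynomial.X j))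

end RayDegeneration

end

/-! Write M for the ideal of the variables, P for the ideal of the i-th axis, 𝔫 for the maximal
ideal of A. In characteristic zero some `x` in 𝔫 has `x ^ s ≠ 0`, and since the Hilbert function is
1 beyond `c`, every element of 𝔫^j with j > c is x^j times a polynomial in x. Correcting the other
generators of 𝔫 by polynomials in x gives a presentation φ with α_i ↦ x whose other coordinates are
killed by x^c. Let 𝔟 = φ(P) be the ideal these generate, ν the least exponent with x^ν ∈ 𝔟, and q ∈
P with φ(q) = x^ν. Then x^(ν+c) = 0, so ν + c > s ≥ 2c and x^(ν-1) kills 𝔟. The proof runs on this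
and on x^(j+1) ∉ 𝔟𝔫^j for j < s (`exists_isRayPresentation`); the second can fail only for (1,n,1)
with n ≥ 2.

Put J = ker φ ∩ P. Over t = a ≠ 0 let φ(w) be the inverse of x - a in A. Modulo J the equation of
the fibre is (α_i - a)(α_i^(ν-1) - wq), and the fibre splits into the point α_i = a on the axis and
the algebra B defined by J and α_i^(ν-1) - wq (`ker_prod_eq`). To compare B with A, recall that dim
Q/(f) = dim Ann(f) in a finite-dimensional algebra Q. In Q = R/(M^(k+1) + J) with k < s, the
elements α_i^ν - q and α_i^(ν-1) - wq have the same annihilator (`mul_mem_pow_sup_iff`). So A and B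
agree in dimension modulo the powers of their maximal ideals up to the s-th, whereas M^s already
vanishes in B.

Flatness over K[t] is torsion-freeness. It is tested in A[t] and in K[α_i][t], because J[t] is the
common kernel of the maps from R[t] to these two rings (`mem_of_map_mul_mem`). -/

noncomputable section

namespace RayDegeneration

open IsLocalRing MvPolynomial

/-! ### Splitting polynomials into a part on the axis and a part off it -/

section Axis

variable {K : Type u} [Field K] {n : ℕ} (i : Fin n)

/-- Restriction of polynomials to the `i`-th coordinate axis. -/
def axisProj : MvPolynomial (Fin n) K →ₐ[K] Polynomial K :=
  aeval (fun j => if j = i then Polynomial.X else 0)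

/-- The inclusion `K[α_i] → K[α_1, …, α_n]`. -/
def axisIncl : Polynomial K →ₐ[K] MvPolynomial (Fin n) K :=
  Polynomial.aeval (X i)

/-- The ideal of the `i`-th coordinate axis. -/
def axisIdeal : Ideal (MvPolynomial (Fin n) K) :=
  RingHom.ker (axisProj (K := K) i)

variable {i}

lemma mem_axisIdeal {r : MvPolynomial (Fin n) K} : r ∈ axisIdeal i ↔ axisProj i r = 0 :=
  Iff.rfl

@[simp]
lemma axisProj_X_self : axisProj (K := K) i (X i) = Polynomial.X := by
  simp [axisProj]

lemma axisProj_X_of_ne {j : Fin n} (h : j ≠ i) : axisProj (K := K) i (X j) = 0 := by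
  simp [axisProj, h]

@[simp]
lemma axisIncl_X : axisIncl (K := K) i Polynomial.X = X i := by
  simp [axisIncl]

@[simp]
lemma axisProj_axisIncl (p : Polynomial K) : axisProj i (axisIncl i p) = p := by
  have : (axisProj (K := K) i).comp (axisIncl i) = AlgHom.id K _ := by
    ext; simp
  exact DFunLike.congr_fun this p

lemma X_mem_axisIdeal {j : Fin n} (h : j ≠ i) : (X j : MvPolynomial (Fin n) K) ∈ axisIdeal i :=
  axisProj_X_of_ne h

lemma sub_axisIncl_mem (r : MvPolynomial (Fin n) K) :
    r - axisIncl i (axisProj i r) ∈ axisIdeal i := by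
  simp [mem_axisIdeal]

lemma sub_axisIncl_mem_span (r : MvPolynomial (Fin n) K) :
    r - axisIncl i (axisProj i r) ∈
      Ideal.span {p : MvPolynomial (Fin n) K | ∃ j, j ≠ i ∧ p = X j} := by
  rw [← Ideal.Quotient.eq_zero_iff_mem, map_sub, sub_eq_zero]
  set Q := Ideal.span {p : MvPolynomial (Fin n) K | ∃ j, j ≠ i ∧ p = X j}
  have : Ideal.Quotient.mkₐ K Q =
      (Ideal.Quotient.mkₐ K Q).comp ((axisIncl i).comp (axisProj i)) := by
    ext j
    by_cases h : j = i
    · subst h; simp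
    · simp only [AlgHom.comp_apply, axisProj_X_of_ne h, map_zero]
      exact Ideal.Quotient.eq_zero_iff_mem.mpr (Ideal.subset_span ⟨j, h, rfl⟩)
  exact DFunLike.congr_fun this r

lemma axisIdeal_eq_span :
    axisIdeal (K := K) i = Ideal.span {p : MvPolynomial (Fin n) K | ∃ j, j ≠ i ∧ p = X j} := by
  apply le_antisymm
  · intro r hr
    have := sub_axisIncl_mem_span (i := i) r
    rwa [mem_axisIdeal.mp hr, map_zero, sub_zero] at this
  · rw [Ideal.span_le]
    rintro _ ⟨j, h, rfl⟩
    exact X_mem_axisIdeal h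

lemma axisIdeal_le_idealOfVars : axisIdeal (K := K) i ≤ idealOfVars (Fin n) K := by
  rw [axisIdeal_eq_span]
  apply Ideal.span_mono
  rintro _ ⟨j, -, rfl⟩
  exact ⟨j, rfl⟩

lemma X_mem_idealOfVars (j : Fin n) : (X j : MvPolynomial (Fin n) K) ∈ idealOfVars (Fin n) K :=
  Ideal.subset_span ⟨j, rfl⟩

lemma idealOfVars_eq_sup : idealOfVars (Fin n) K = Ideal.span {X i} ⊔ axisIdeal i := by
  apply le_antisymm
  · refine Ideal.span_le.mpr ?_
    rintro _ ⟨j, rfl⟩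
    by_cases h : j = i
    · subst h
      exact Ideal.mem_sup_left (Ideal.mem_span_singleton_self _)
    · exact Ideal.mem_sup_right (X_mem_axisIdeal h)
  · refine sup_le ?_ axisIdeal_le_idealOfVars
    rw [Ideal.span_singleton_le_iff_mem]
    exact X_mem_idealOfVars i

/-- A monomial of degree k + 1 is either the pure power of α_i or has another variable to split off.
-/
lemma idealOfVars_pow_succ_le (k : ℕ) : idealOfVars (Fin n) K ^ (k + 1) ≤
    Ideal.span {X i ^ (k + 1)} ⊔ axisIdeal i * idealOfVars (Fin n) K ^ k := by
  induction k with
  | zero => simp [← idealOfVars_eq_sup]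
  | succ k ih =>
    rw [pow_succ (idealOfVars (Fin n) K) (k + 1)]
    refine (Ideal.mul_mono_left ih).trans ?_
    rw [Ideal.sup_mul, mul_assoc, ← pow_succ]
    refine sup_le ?_ le_sup_right
    nth_rewrite 1 [idealOfVars_eq_sup (i := i)]
    rw [Ideal.mul_sup, Ideal.span_singleton_mul_span_singleton, ← pow_succ]
    refine sup_le_sup_left ?_ _
    rw [mul_comm]
    refine Ideal.mul_mono_right ?_
    rw [Ideal.span_singleton_le_iff_mem]
    exact Ideal.pow_mem_pow (X_mem_idealOfVars i) _

lemma axisProj_mem_of_mem_pow {k : ℕ} {r : MvPolynomial (Fin n) K}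
    (hr : r ∈ idealOfVars (Fin n) K ^ k) : Polynomial.X ^ k ∣ axisProj i r := by
  have h1 : (idealOfVars (Fin n) K).map (axisProj i) ≤ Ideal.span {Polynomial.X} := by
    rw [idealOfVars_eq_sup (i := i), Ideal.map_sup, Ideal.map_span, Set.image_singleton,
      axisProj_X_self]
    refine sup_le le_rfl ?_
    rw [Ideal.map_le_iff_le_comap]
    intro p hp
    rw [Ideal.mem_comap, mem_axisIdeal.mp hp]
    exact zero_mem _
  have h2 := Ideal.mem_map_of_mem (axisProj i) hr
  rw [Ideal.map_pow] at h2
  have h3 := Ideal.pow_right_mono h1 k h2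
  rwa [Ideal.span_singleton_pow, Ideal.mem_span_singleton] at h3

lemma sub_axisIncl_mem_mul {k : ℕ} {r : MvPolynomial (Fin n) K}
    (hr : r ∈ idealOfVars (Fin n) K ^ (k + 1)) :
    r - axisIncl i (axisProj i r) ∈ axisIdeal i * idealOfVars (Fin n) K ^ k := by
  obtain ⟨a, b, hb, h⟩ :=
    Ideal.mem_span_singleton_sup.mp (SetLike.le_def.mp (idealOfVars_pow_succ_le (i := i) k) hr)
  have hb0 : axisProj i b = 0 := mem_axisIdeal.mp (Ideal.mul_le_left hb)
  have h2 : axisIncl i (axisProj i r) = axisIncl i (axisProj i a) * X i ^ (k + 1) := by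
    rw [← h, map_add, hb0, add_zero, map_mul, map_pow, axisProj_X_self, map_mul, map_pow,
      axisIncl_X]
  have h3 : r - axisIncl i (axisProj i r) =
      (a - axisIncl i (axisProj i a)) * X i ^ (k + 1) + b := by
    rw [h2, ← h]; ring
  rw [h3]
  refine add_mem (Ideal.mul_mem_mul (sub_axisIncl_mem a) ?_) hb
  exact Ideal.pow_le_pow_right (Nat.le_succ k) (Ideal.pow_mem_pow (X_mem_idealOfVars i) _)

lemma rayProj_coe (r : MvPolynomial (Fin n) K) :
    rayProj K i (r : MvPowerSeries (Fin n) K) = (axisProj i r : PowerSeries K) := by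
  have : ((rayProj K i).comp (coeToMvPowerSeries.algHom K)) =
      (Polynomial.coeToPowerSeries.algHom K).comp (axisProj i) := by
    ext j : 1
    by_cases h : j = i
    · subst h
      simp only [AlgHom.comp_apply, axisProj_X_self]
      simp only [coeToMvPowerSeries.algHom_apply, coe_X, Polynomial.coeToPowerSeries.algHom_apply,
        Polynomial.coe_X]
      simp [rayProj]
      exact MvPowerSeries.killCompl_X (R := K)
        (e := (⟨fun _ : Unit => j, Function.injective_of_subsingleton _⟩ : Unit ↪ Fin n)) ()
    · simp only [AlgHom.comp_apply, axisProj_X_of_ne h, map_zero]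
      simp only [coeToMvPowerSeries.algHom_apply, coe_X]
      simp [rayProj]
      exact MvPowerSeries.killCompl_X_eq_zero (by rintro ⟨_, rfl⟩; exact h rfl)
  simpa using DFunLike.congr_fun this r

end Axis

/-! ### Polarization: an element with nonzero s-th power -/

section Polarization

variable {K : Type u} [Field K] {A : Type v} [CommRing A] [Algebra K A]

/-- Linear functionals applied to the coefficients reduce this to polynomials over the infinite
field K. -/
lemma polynomial_eq_zero_of_eval_algebraMap [Infinite K] {f : Polynomial A}
    (hf : ∀ a : K, f.eval (algebraMap K A a) = 0) : f = 0 := by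
  ext k
  rw [Polynomial.coeff_zero, ← Module.forall_dual_apply_eq_zero_iff K]
  intro l
  let g : Polynomial K :=
    ∑ k ∈ Finset.range (f.natDegree + 1), Polynomial.monomial k (l (f.coeff k))
  have hg : g = 0 := by
    apply Polynomial.funext
    intro a
    rw [Polynomial.eval_zero, ← map_zero l, ← hf a, Polynomial.eval_finsetSum,
      Polynomial.eval_eq_sum_range, map_sum]
    refine Finset.sum_congr rfl fun k _ => ?_
    rw [Polynomial.eval_monomial, ← map_pow, mul_comm (f.coeff k), ← Algebra.smul_def, map_smul,
      smul_eq_mul, mul_comm]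
  have h := congrArg (fun g => Polynomial.coeff g k) hg
  simp only [g, Polynomial.finsetSum_coeff, Polynomial.coeff_monomial, Polynomial.coeff_zero,
    Finset.sum_ite_eq', Finset.mem_range] at h
  split_ifs at h with hk
  · exact h
  · rw [Polynomial.coeff_eq_zero_of_natDegree_lt (by omega), map_zero]

/-- If all `s`-th powers of elements of an ideal vanish, then so does its `s`-th power. -/
lemma ideal_pow_eq_bot_of_forall_pow_eq_zero [CharZero K] {I : Ideal A} {s : ℕ}
    (h : ∀ y ∈ I, y ^ s = 0) : I ^ s = ⊥ := by
  have key : ∀ k ≤ s, ∀ w ∈ I ^ k, ∀ y ∈ I, y ^ (s - k) * w = 0 := by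
    intro k
    induction k with
    | zero => intro _ w _ y hy; simp [h y hy]
    | succ k ih =>
      intro hk w hw y hy
      rw [pow_succ] at hw
      refine Submodule.mul_induction_on hw ?_ ?_
      · intro w hw z hz
        -- Move y along the line y + az in I. The derivative at a = 0 is (s - k) y^(s-k-1) z w, and
        -- s - k is invertible in characteristic zero.
        have hf : (Polynomial.C y + Polynomial.C z * Polynomial.X) ^ (s - k) * Polynomial.C w
            = 0 := by
          apply polynomial_eq_zero_of_eval_algebraMap (K := K)
          intro a
          have := ih (by omega) w hw (y + z * algebraMap K A a)
            (I.add_mem hy (I.mul_mem_right _ hz))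
          simpa using this
        have hd := congrArg (fun f => (Polynomial.derivative f).eval 0) hf
        simp only [Polynomial.derivative_mul, Polynomial.derivative_pow] at hd
        simp only [map_add, Polynomial.derivative_C, Polynomial.derivative_mul, zero_mul,
          Polynomial.derivative_X, mul_one, zero_add, mul_zero, add_zero, Polynomial.eval_mul,
          Polynomial.eval_C, Polynomial.eval_pow, Polynomial.eval_add, Polynomial.eval_X,
          map_zero, Polynomial.eval_zero] at hd
        have he : s - k - 1 = s - (k + 1) := by omega
        rw [he] at hd
        have hu : IsUnit ((s - k : ℕ) : A) := by
          have : ((s - k : ℕ) : K) ≠ 0 := Nat.cast_ne_zero.mpr (by omega)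
          simpa using (this.isUnit.map (algebraMap K A))
        apply hu.mul_left_cancel
        rw [mul_zero, ← hd]
        ring
      · intro a b ha hb
        rw [mul_add, ha, hb, add_zero]
  rw [eq_bot_iff]
  intro w hw
  simpa using key s le_rfl w hw 0 (zero_mem _)

end Polarization

/-! ### Finite local algebras: the tail of the Hilbert function, generators -/

section Local

variable {K : Type u} [Field K] {A : Type v} [CommRing A] [IsLocalRing A] [Algebra K A]

lemma exists_sub_algebraMap_mem_maximalIdeal [IsAlgClosed K] [Module.Finite K A] (a : A) :
    ∃ k : K, a - algebraMap K A k ∈ maximalIdeal A := by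
  have : Module.Finite K (ResidueField A) :=
    Module.Finite.of_surjective (IsScalarTower.toAlgHom K A (ResidueField A)).toLinearMap
      IsLocalRing.residue_surjective
  obtain ⟨k, hk⟩ := (IsAlgClosed.algebraMap_bijective_of_isIntegral
    (k := K) (K := ResidueField A)).2 (residue A a)
  refine ⟨k, ?_⟩
  rw [← residue_eq_zero_iff, map_sub, sub_eq_zero, ← hk]
  rfl

lemma maximalIdeal_pow_succ_socleDegree {s : ℕ} (hs : IsSocleDegree A s) :
    maximalIdeal A ^ (s + 1) = ⊥ := by
  by_contra h
  have := hs.2 h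
  omega

lemma exists_pow_ne_zero [CharZero K] {s : ℕ} (hs : IsSocleDegree A s) :
    ∃ x ∈ maximalIdeal A, x ^ s ≠ 0 := by
  by_contra! h
  exact hs.1 (ideal_pow_eq_bot_of_forall_pow_eq_zero (K := K) h)

lemma pow_notMem_of_pow_ne_zero {s : ℕ} (hs : maximalIdeal A ^ (s + 1) = ⊥) {x : A}
    (hx : x ∈ maximalIdeal A) (hxs : x ^ s ≠ 0) {j : ℕ} (hj : j ≤ s) :
    x ^ j ∉ maximalIdeal A ^ (j + 1) := by
  intro h
  apply hxs
  have h1 : x ^ j * x ^ (s - j) ∈ maximalIdeal A ^ (j + 1) * maximalIdeal A ^ (s - j) :=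
    Ideal.mul_mem_mul h (Ideal.pow_mem_pow hx _)
  rw [← pow_add, ← pow_add, show j + 1 + (s - j) = s + 1 by omega, hs,
    show j + (s - j) = s by omega] at h1
  simpa using h1

/-- Where the Hilbert function is `1`, the powers of the maximal ideal consist of polynomials in
a fixed element `x` with `x ^ s ≠ 0`. -/
lemma exists_aeval_of_mem_pow {c s : ℕ} (hs : maximalIdeal A ^ (s + 1) = ⊥) {x : A}
    (hx : x ∈ maximalIdeal A) (hxs : x ^ s ≠ 0)
    (htail : ∀ j, c < j → j ≤ s → hilbertFunction K A j = 1) {j : ℕ} (hj : c < j) {a : A}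
    (ha : a ∈ maximalIdeal A ^ j) :
    ∃ p : Polynomial K, a = x ^ j * Polynomial.aeval x p := by
  -- Descending induction on j: the quotient of 𝔫^j by 𝔫^(j+1) is the line through x^j, so
  -- subtracting a scalar multiple of x^j from a leaves an element of 𝔫^(j+1).
  induction hd : s + 1 - j generalizing j a with
  | zero =>
    have : a ∈ maximalIdeal A ^ (s + 1) := Ideal.pow_le_pow_right (by omega) ha
    rw [hs] at this
    exact ⟨0, by simpa using this⟩
  | succ d ih =>
    have hjs : j ≤ s := by omega
    have h1 := htail j hj hjs
    set N := (maximalIdeal A ^ (j + 1)).submoduleOf (maximalIdeal A ^ j)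
    let v : ↥(maximalIdeal A ^ j) := ⟨x ^ j, Ideal.pow_mem_pow hx j⟩
    have hv : N.mkQ v ≠ 0 := by
      rw [Ne, Submodule.mkQ_apply, Submodule.Quotient.mk_eq_zero]
      exact pow_notMem_of_pow_ne_zero hs hx hxs hjs
    obtain ⟨k, hk⟩ := (finrank_eq_one_iff_of_nonzero' (K := K) (N.mkQ v) hv).mp h1
      (N.mkQ ⟨a, ha⟩)
    have hmem : a - k • x ^ j ∈ maximalIdeal A ^ (j + 1) := by
      have h2 : N.mkQ (⟨a, ha⟩ - k • v) = 0 := by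
        rw [map_sub, sub_eq_zero, ← hk]
        rfl
      rw [Submodule.mkQ_apply, Submodule.Quotient.mk_eq_zero] at h2
      exact h2
    obtain ⟨p, hp⟩ := ih (by omega) hmem (by omega)
    refine ⟨Polynomial.C k + Polynomial.X * p, ?_⟩
    rw [map_add, Polynomial.aeval_C, map_mul, Polynomial.aeval_X, mul_add, ← mul_assoc,
      ← pow_succ, ← hp, Algebra.smul_def]
    ring

lemma isUnit_aeval_of_isNilpotent {A : Type v} [CommRing A] [Algebra K A] {x : A}
    (hx : IsNilpotent x) {p : Polynomial K} (hp : p.coeff 0 ≠ 0) :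
    IsUnit (Polynomial.aeval x p) := by
  rw [← Polynomial.divX_mul_X_add p, map_add, map_mul, Polynomial.aeval_X, Polynomial.aeval_C]
  refine IsNilpotent.isUnit_add_right_of_commute ?_ ?_ (Commute.all _ _)
  · exact (Commute.all _ _).isNilpotent_mul_left hx
  · exact hp.isUnit.map (algebraMap K A)

lemma exists_eq_X_pow_mul_of_ne_zero {p : Polynomial K} (hp : p ≠ 0) :
    ∃ k, ∃ p' : Polynomial K, p = Polynomial.X ^ k * p' ∧ p'.coeff 0 ≠ 0 := by
  obtain ⟨p', h1, h2⟩ := Polynomial.exists_eq_pow_rootMultiplicity_mul_and_not_dvd p hp 0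
  rw [Polynomial.C_0, sub_zero] at h1 h2
  exact ⟨_, p', h1, fun h => h2 (Polynomial.X_dvd_iff.mpr h)⟩

/-- A set of lifts of a basis of `𝔫/𝔫²` that contains a given `x ∈ 𝔫 ∖ 𝔫²` generates `𝔫`. -/
lemma exists_generators [Module.Finite K A] {n : ℕ} (hn : hilbertFunction K A 1 = n)
    {x : A} (hx : x ∈ maximalIdeal A) (hx2 : x ∉ maximalIdeal A ^ 2) :
    ∃ (i : Fin n) (g : Fin n → A), g i = x ∧ Ideal.span (Set.range g) = maximalIdeal A := by
  have : IsNoetherianRing A := IsNoetherianRing.of_finite K A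
  set I := maximalIdeal A ^ 1 with hI
  set N := (maximalIdeal A ^ 2).submoduleOf I
  have : Module.Finite K I :=
    Module.Finite.of_injective (I.subtype.restrictScalars K) Subtype.val_injective
  have hxI : x ∈ I := by rwa [hI, pow_one]
  have hv : N.mkQ ⟨x, hxI⟩ ≠ 0 := by
    rw [Ne, Submodule.mkQ_apply, Submodule.Quotient.mk_eq_zero]
    exact hx2
  have hli : LinearIndepOn K id {N.mkQ ⟨x, hxI⟩} := LinearIndepOn.singleton hv
  let b := Module.Basis.extend hli
  have hfin : Module.finrank K (↥I ⧸ N) = n := hn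
  have hcard : Nat.card (hli.extend (Set.subset_univ _)) = n := by
    rw [← hfin, Module.finrank_eq_nat_card_basis b]
  have : Finite (hli.extend (Set.subset_univ _)) := Module.Finite.finite_basis b
  let e := Finite.equivFinOfCardEq hcard
  let i := e ⟨N.mkQ ⟨x, hxI⟩, hli.subset_extend _ rfl⟩
  have hlift : ∀ j : Fin n, ∃ a : I, N.mkQ a = b (e.symm j) ∧ (j = i → a = ⟨x, hxI⟩) := by
    intro j
    by_cases hj : j = i
    · refine ⟨⟨x, hxI⟩, ?_, fun _ => rfl⟩
      rw [hj, Equiv.symm_apply_apply, Module.Basis.extend_apply_self]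
    · obtain ⟨a, ha⟩ := N.mkQ_surjective (b (e.symm j))
      exact ⟨a, ha, fun h => absurd h hj⟩
  choose g hg hgi using hlift
  refine ⟨i, fun j => g j, by simp [hgi i rfl], ?_⟩
  set G := Ideal.span (Set.range fun j => (g j : A))
  have hGle : G ≤ maximalIdeal A := by
    rw [Ideal.span_le]
    rintro _ ⟨j, rfl⟩
    exact Ideal.pow_le_self one_ne_zero (g j).2
  refine le_antisymm hGle ?_
  -- Nakayama: it suffices that 𝔫 ⊆ G + 𝔫².
  refine Submodule.le_of_le_smul_of_le_jacobson_bot (I := maximalIdeal A)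
    (IsNoetherian.noetherian _) (IsLocalRing.maximalIdeal_le_jacobson _) ?_
  intro a ha
  have haI : a ∈ I := by rwa [hI, pow_one]
  have hsum := (b.reindex e).sum_repr (N.mkQ ⟨a, haI⟩)
  have h0 : N.mkQ (⟨a, haI⟩ - ∑ j, (b.reindex e).repr (N.mkQ ⟨a, haI⟩) j • g j) = 0 := by
    rw [map_sub, sub_eq_zero, map_sum]
    conv_lhs => rw [← hsum]
    refine Finset.sum_congr rfl fun j _ => ?_
    rw [Module.Basis.reindex_apply, ← hg j]
    rfl
  rw [Submodule.mkQ_apply, Submodule.Quotient.mk_eq_zero] at h0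
  have h1 : a - ∑ j, (b.reindex e).repr (N.mkQ ⟨a, haI⟩) j • (g j : A) ∈ maximalIdeal A ^ 2 := by
    have : ((⟨a, haI⟩ - ∑ j, (b.reindex e).repr (N.mkQ ⟨a, haI⟩) j • g j : I) : A) ∈
      maximalIdeal A ^ 2 := h0
    simpa using! this
  rw [smul_eq_mul, ← pow_two, ← sub_add_cancel a
    (∑ j, (b.reindex e).repr (N.mkQ ⟨a, haI⟩) j • (g j : A)), add_comm]
  refine add_mem (Ideal.mem_sup_left (sum_mem fun j _ => ?_)) (Ideal.mem_sup_right h1)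
  rw [Algebra.smul_def]
  exact G.mul_mem_left _ (Ideal.subset_span ⟨j, rfl⟩)

/-- By descending induction 𝔫^k lies in the range: it is generated by images of polynomials, and
each coefficient is a scalar plus an element of 𝔫, whose contribution falls into 𝔫^(k+1). -/
lemma aeval_surjective_of_span_eq_maximalIdeal [IsAlgClosed K] [Module.Finite K A] {n s : ℕ}
    (hs : maximalIdeal A ^ (s + 1) = ⊥) {φ : MvPolynomial (Fin n) K →ₐ[K] A}
    (hφ : (idealOfVars (Fin n) K).map φ = maximalIdeal A) : Function.Surjective φ := by
  have key : ∀ d k, s + 1 - k = d → ∀ a ∈ maximalIdeal A ^ k, a ∈ φ.range := by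
    intro d
    induction d with
    | zero =>
      intro k hk a ha
      have : a ∈ maximalIdeal A ^ (s + 1) := Ideal.pow_le_pow_right (by omega) ha
      rw [hs] at this
      rw [(Submodule.mem_bot A).mp this]
      exact zero_mem _
    | succ d ih =>
      intro k hk a ha
      have ha' := ha
      rw [← hφ, ← Ideal.map_pow, Ideal.map] at ha'
      have hmul : ∀ b : A, b * a ∈ φ.range := by
        refine Submodule.span_induction (p := fun a _ => ∀ b : A, b * a ∈ φ.range)
          ?_ ?_ ?_ ?_ ha'
        · rintro _ ⟨m, hm, rfl⟩ b
          obtain ⟨l, hl⟩ := exists_sub_algebraMap_mem_maximalIdeal (K := K) b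
          rw [← sub_add_cancel b (algebraMap K A l), add_mul]
          refine add_mem (ih (k + 1) (by omega) _ ?_) ⟨C l * m, by simp⟩
          rw [pow_succ']
          refine Ideal.mul_mem_mul hl ?_
          rw [← hφ, ← Ideal.map_pow]
          exact Ideal.mem_map_of_mem φ hm
        · intro b
          rw [mul_zero]
          exact zero_mem _
        · intro a₁ a₂ _ _ h1 h2 b
          rw [mul_add]
          exact add_mem (h1 b) (h2 b)
        · intro d a₁ _ h1 b
          rw [smul_eq_mul, ← mul_assoc]
          exact h1 _
      simpa using hmul 1
  intro a
  exact key (s + 1) 0 rfl a (by simp)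

end Local

/-! ### Presentations adapted to an axis -/

section Presentation

variable {K : Type u} [Field K] {A : Type v} [CommRing A] [Algebra K A] {n : ℕ}

/-- A presentation `φ : K[α_1, …, α_n] → A` of an algebra whose maximal ideal `𝔫` has nilpotency
index at most `s + 1`, adapted to the `i`-th axis: `α_i^ν - q` is in the kernel, `ν` is the ray
order, the ideal `𝔟` generated by the other coordinates is annihilated by `α_i^(ν-1)`, and
no `α_i^j` with `1 ≤ j ≤ s` lies in `𝔟 𝔫^(j-1)`. -/
structure IsRayPresentation (φ : MvPolynomial (Fin n) K →ₐ[K] A) (i : Fin n) (s ν : ℕ)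
    (q : MvPolynomial (Fin n) K) : Prop where
  surjective : Function.Surjective φ
  q_mem : q ∈ axisIdeal i
  map_q : φ q = φ (X i ^ ν)
  dvd_of_map_eq_zero : ∀ r, φ r = 0 → Polynomial.X ^ ν ∣ axisProj i r
  map_X_pow_mul : ∀ r ∈ axisIdeal i, φ (X i ^ (ν - 1) * r) = 0
  map_eq_zero_of_mem_pow : ∀ r ∈ idealOfVars (Fin n) K ^ (s + 1), φ r = 0
  pos : 1 ≤ s
  two_le : 2 ≤ ν
  le_succ : ν ≤ s + 1
  notMem : ∀ j < s, φ (X i ^ (j + 1)) ∉ (axisIdeal i * idealOfVars (Fin n) K ^ j).map φ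
  map_eq_zero_of_mem_mul : ∀ r ∈ axisIdeal i * idealOfVars (Fin n) K ^ (s - 1), φ r = 0

end Presentation

/-! ### Existence of an adapted presentation -/

section Existence

variable {K : Type u} [Field K] {A : Type v} [CommRing A] [IsLocalRing A] [Algebra K A]

lemma exists_presentation_mul_pow_eq_zero [IsAlgClosed K] [Module.Finite K A] {n c s : ℕ}
    (hn : hilbertFunction K A 1 = n) (hs : maximalIdeal A ^ (s + 1) = ⊥) {x : A}
    (hx : x ∈ maximalIdeal A) (hxs : x ^ s ≠ 0) (hs_pos : 1 ≤ s)
    (htail : ∀ j, c < j → j ≤ s → hilbertFunction K A j = 1) :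
    ∃ (i : Fin n) (φ : MvPolynomial (Fin n) K →ₐ[K] A), Function.Surjective φ ∧ φ (X i) = x ∧
      (idealOfVars (Fin n) K).map φ = maximalIdeal A ∧
      ∀ r ∈ axisIdeal i, φ r * x ^ c = 0 := by
  have hx2 : x ∉ maximalIdeal A ^ 2 := by
    simpa using pow_notMem_of_pow_ne_zero hs hx hxs hs_pos
  obtain ⟨i, g, hgi, hg⟩ := exists_generators (K := K) hn hx hx2
  have hgm : ∀ j, g j ∈ maximalIdeal A := fun j => hg ▸ Ideal.subset_span ⟨j, rfl⟩
  have hp : ∀ j, ∃ p : Polynomial K, g j * x ^ c = x ^ (c + 1) * Polynomial.aeval x p := by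
    intro j
    refine exists_aeval_of_mem_pow hs hx hxs htail (Nat.lt_succ_self c) ?_
    rw [pow_succ']
    exact Ideal.mul_mem_mul (hgm j) (Ideal.pow_mem_pow hx c)
  choose p hp using hp
  -- Since g_j x^c = x^c · x p_j(x), subtracting x p_j(x) gives a generator killed by x^c.
  let g' : Fin n → A := fun j => if j = i then x else g j - x * Polynomial.aeval x (p j)
  have hg'i : g' i = x := by simp [g']
  have hg' : ∀ j, j ≠ i → g' j = g j - x * Polynomial.aeval x (p j) := fun j hj => by simp [g', hj]
  let φ : MvPolynomial (Fin n) K →ₐ[K] A := aeval g'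
  have hφ : ∀ j, φ (X j) = g' j := fun j => aeval_X _ _
  have hmap : (idealOfVars (Fin n) K).map φ = maximalIdeal A := by
    apply le_antisymm
    · rw [Ideal.map_le_iff_le_comap]
      refine Ideal.span_le.mpr ?_
      rintro _ ⟨j, rfl⟩
      change φ (X j) ∈ maximalIdeal A
      rw [hφ]
      by_cases hj : j = i
      · rwa [hj, hg'i]
      · rw [hg' j hj]
        exact sub_mem (hgm j) (Ideal.mul_mem_right _ _ hx)
    · rw [← hg, Ideal.span_le]
      rintro _ ⟨j, rfl⟩
      have hmem : ∀ j, g' j ∈ (idealOfVars (Fin n) K).map φ := fun j => by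
        rw [← hφ]
        exact Ideal.mem_map_of_mem φ (X_mem_idealOfVars j)
      by_cases hj : j = i
      · have := hmem i
        rw [hj, hgi]
        rwa [hg'i] at this
      · have : g j = g' j + g' i * Polynomial.aeval x (p j) := by
          rw [hg' j hj, hg'i]; ring
        rw [this]
        exact add_mem (hmem j) (Ideal.mul_mem_right _ _ (hmem i))
  refine ⟨i, φ, aeval_surjective_of_span_eq_maximalIdeal hs hmap, by rw [hφ, hg'i], hmap, ?_⟩
  intro r hr
  rw [axisIdeal_eq_span] at hr
  refine Submodule.span_induction (p := fun r _ => φ r * x ^ c = 0) ?_ (by simp) ?_ ?_ hr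
  · rintro _ ⟨j, hj, rfl⟩
    rw [hφ, hg' j hj, sub_mul, hp]
    ring
  · intro a b _ _ ha hb
    rw [map_add, add_mul, ha, hb, add_zero]
  · intro a b _ hb
    rw [smul_eq_mul, map_mul, mul_assoc, hb, mul_zero]

theorem exists_isRayPresentation [IsAlgClosed K] [CharZero K] [Module.Finite K A] {n c s : ℕ}
    (hn : hilbertFunction K A 1 = n) (hs : IsSocleDegree A s)
    (htail : ∀ j, c < j → j ≤ s → hilbertFunction K A j = 1)
    (hs_pos : 1 ≤ s) (hsc : 2 * c ≤ s) (hexc : s = 2 → n = 1) :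
    ∃ (i : Fin n) (φ : MvPolynomial (Fin n) K →ₐ[K] A) (ν : ℕ) (q : MvPolynomial (Fin n) K),
      (idealOfVars (Fin n) K).map φ = maximalIdeal A ∧ IsRayPresentation φ i s ν q := by
  have hs1 := maximalIdeal_pow_succ_socleDegree hs
  obtain ⟨x, hx, hxs⟩ := exists_pow_ne_zero (K := K) hs
  obtain ⟨i, φ, hsurj, hφx, hmap, hann⟩ :=
    exists_presentation_mul_pow_eq_zero (K := K) hn hs1 hx hxs hs_pos htail
  have hpow0 : ∀ k, s < k → x ^ k = 0 := by
    intro k hk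
    have : x ^ k ∈ maximalIdeal A ^ (s + 1) :=
      Ideal.pow_le_pow_right hk (Ideal.pow_mem_pow hx k)
    rwa [hs1] at this
  have hpowne : ∀ k, x ^ k = 0 → s < k := by
    intro k hk
    by_contra hlt
    exact hxs (by rw [← Nat.sub_add_cancel (not_lt.mp hlt), pow_add, hk, mul_zero])
  have hmapmem : ∀ {k : ℕ} {r : MvPolynomial (Fin n) K}, r ∈ idealOfVars (Fin n) K ^ k →
      φ r ∈ maximalIdeal A ^ k := by
    intro k r hr
    rw [← hmap, ← Ideal.map_pow]
    exact Ideal.mem_map_of_mem φ hr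
  set P := axisIdeal (K := K) i
  have hP0 : ∀ a ∈ P.map φ, a * x ^ c = 0 := by
    intro a ha
    obtain ⟨r, hr, rfl⟩ := (Ideal.mem_map_iff_of_surjective φ hsurj).mp ha
    exact hann r hr
  have hPn : ∀ j, c < j → P.map φ * maximalIdeal A ^ j = ⊥ := by
    intro j hj
    rw [eq_bot_iff, Ideal.mul_le]
    intro a ha b hb
    obtain ⟨p, rfl⟩ := exists_aeval_of_mem_pow hs1 hx hxs htail hj hb
    rw [Ideal.mem_bot, ← Nat.sub_add_cancel hj.le, pow_add, mul_assoc, mul_left_comm,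
      ← mul_assoc a, hP0 a ha, zero_mul, mul_zero]
  have hPM : ∀ j, (P * idealOfVars (Fin n) K ^ j).map φ = P.map φ * maximalIdeal A ^ j := by
    intro j
    rw [Ideal.map_mul, Ideal.map_pow, hmap]
  classical
  have hex : ∃ k, x ^ k ∈ P.map φ := ⟨s + 1, by rw [hpow0 _ (Nat.lt_succ_self s)]; exact zero_mem _⟩
  set ν := Nat.find hex
  have hνmem : x ^ ν ∈ P.map φ := Nat.find_spec hex
  have hνmin : ∀ k, x ^ k ∈ P.map φ → ν ≤ k := fun k hk => Nat.find_min' hex hk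
  -- Together with 2c ≤ s this yields ν - 1 ≥ c, so that x^(ν-1) kills 𝔟; with s ≥ 1 it also yields
  -- ν ≥ 2.
  have hνc : s < ν + c := hpowne _ (by rw [pow_add, hP0 _ hνmem])
  obtain ⟨q, hq, hqν⟩ := (Ideal.mem_map_iff_of_surjective φ hsurj).mp hνmem
  have hnot : ∀ j < s, φ (X i ^ (j + 1)) ∉ (P * idealOfVars (Fin n) K ^ j).map φ := by
    intro j hj hmem
    rw [hPM, map_pow, hφx] at hmem
    have hνj := hνmin _ (Ideal.mul_le_left hmem)
    -- For j > c the ideal 𝔟𝔫^j is zero. For j ≤ c, the bounds ν ≤ j + 1 and s < ν + c leave only j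
    -- = c and s = 2c.
    rcases Nat.lt_or_ge c j with hcj | hcj
    · rw [hPn j hcj] at hmem
      have := hpowne _ hmem
      omega
    · obtain rfl : j = c := by omega
      obtain rfl : s = 2 * j := by omega
      rcases Nat.lt_or_ge 1 j with h1 | h1
      · have h2 : x ^ (j + 1) * x ^ (j - 1) ∈
            P.map φ * maximalIdeal A ^ j * maximalIdeal A ^ (j - 1) :=
          Ideal.mul_mem_mul hmem (Ideal.pow_mem_pow hx _)
        rw [mul_assoc, ← pow_add, ← pow_add, hPn _ (by omega)] at h2
        have := hpowne _ h2
        omega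
      · obtain rfl : j = 1 := by omega
        -- Now s = 2 and the Hilbert function is (1,n,1). The exclusion forces n = 1, so there are
        -- no coordinates off the axis and 𝔟 = 0.
        obtain rfl := hexc rfl
        have hPbot : P = ⊥ := by
          rw [eq_bot_iff]
          change axisIdeal i ≤ ⊥
          rw [axisIdeal_eq_span, Ideal.span_le]
          rintro _ ⟨k, hk, -⟩
          exact absurd (Subsingleton.elim k i) hk
        rw [hPbot, Ideal.map_bot, Ideal.bot_mul] at hmem
        have := hpowne _ hmem
        omega
  refine ⟨i, φ, ν, q, hmap, hsurj, hq, by rw [hqν, map_pow, hφx], ?_, ?_, ?_, hs_pos, by omega,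
    hνmin _ (by rw [hpow0 _ (Nat.lt_succ_self s)]; exact zero_mem _), hnot, ?_⟩
  · intro r hr
    by_cases h0 : axisProj i r = 0
    · rw [h0]; exact dvd_zero _
    -- As φ(r) = 0, the axis part of r takes a value in 𝔟 at x. That value is x^k times a unit, so
    -- x^k ∈ 𝔟 and ν ≤ k.
    · obtain ⟨k, p, hkp, hp⟩ := exists_eq_X_pow_mul_of_ne_zero h0
      rw [hkp]
      refine Dvd.dvd.mul_right (pow_dvd_pow _ (hνmin k ?_)) _
      have h1 : φ (axisIncl i (axisProj i r)) ∈ P.map φ := by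
        have := Ideal.mem_map_of_mem φ (sub_axisIncl_mem (i := i) r)
        rw [map_sub, hr, zero_sub] at this
        exact (neg_mem_iff).mp this
      have h2 : ∀ p : Polynomial K, φ (axisIncl i p) = Polynomial.aeval x p := by
        intro p
        rw [axisIncl, ← Polynomial.aeval_algHom_apply, hφx]
      rw [h2, hkp, map_mul, map_pow, Polynomial.aeval_X] at h1
      exact (Ideal.mul_unit_mem_iff_mem _
        (isUnit_aeval_of_isNilpotent ⟨s + 1, hpow0 _ (Nat.lt_succ_self s)⟩ hp)).mp h1
  · intro r hr
    rw [map_mul, map_pow, hφx, show ν - 1 = c + (ν - 1 - c) by omega, pow_add, mul_right_comm,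
      mul_comm _ (φ r), hann r hr, zero_mul]
  · intro r hr
    have := hmapmem hr
    rwa [hs1] at this
  · intro r hr
    have hr' : φ r ∈ maximalIdeal A ^ s := by
      apply hmapmem
      have := Ideal.mul_mono_left axisIdeal_le_idealOfVars hr
      rwa [← pow_succ', Nat.sub_add_cancel hs_pos] at this
    obtain ⟨p, hp⟩ := exists_aeval_of_mem_pow hs1 hx hxs htail (by omega) hr'
    by_cases h0 : p.coeff 0 = 0
    · obtain ⟨p', rfl⟩ := Polynomial.X_dvd_iff.mpr h0
      rw [hp, map_mul, Polynomial.aeval_X, ← mul_assoc, ← pow_succ,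
        hpow0 _ (Nat.lt_succ_self s), zero_mul]
    -- Here φ(r) is x^s times a unit, which would put x^s into 𝔟𝔫^(s-1).
    · exfalso
      refine hnot (s - 1) (by omega) ?_
      have h1 := Ideal.mem_map_of_mem φ hr
      rw [hp] at h1
      have h2 := (Ideal.mul_unit_mem_iff_mem _
        (isUnit_aeval_of_isNilpotent ⟨s + 1, hpow0 _ (Nat.lt_succ_self s)⟩ h0)).mp h1
      rwa [map_pow, hφx, Nat.sub_add_cancel hs_pos]

end Existence

/-! ### Dimension counts, integrality and local quotients -/

section Dimension

variable {K : Type u} [Field K]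

lemma finrank_quotient_add_finrank_of_tower {C V : Type*} [CommRing C] [Algebra K C]
    [AddCommGroup V] [Module C V] [Module K V] [IsScalarTower K C V] [Module.Finite K V]
    (N : Submodule C V) :
    Module.finrank K (V ⧸ N) + Module.finrank K N = Module.finrank K V := by
  rw [← (Submodule.Quotient.restrictScalarsEquiv K N).finrank_eq]
  exact Submodule.finrank_quotient_add_finrank (N.restrictScalars K)

lemma finite_submodule_of_tower {C V : Type*} [CommRing C] [Algebra K C]
    [AddCommGroup V] [Module C V] [Module K V] [IsScalarTower K C V] [Module.Finite K V]
    (N : Submodule C V) : Module.Finite K N :=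
  Module.Finite.of_injective (N.subtype.restrictScalars K) Subtype.val_injective

lemma hilbertFunction_add_finrank {C : Type*} [CommRing C] [IsLocalRing C] [Algebra K C]
    [Module.Finite K C] (j : ℕ) :
    hilbertFunction K C j + Module.finrank K (C ⧸ maximalIdeal C ^ j) =
      Module.finrank K (C ⧸ maximalIdeal C ^ (j + 1)) := by
  have := finite_submodule_of_tower (K := K) (maximalIdeal C ^ j)
  have h1 := finrank_quotient_add_finrank_of_tower (K := K)
    ((maximalIdeal C ^ (j + 1)).submoduleOf (maximalIdeal C ^ j))
  have h2 := finrank_quotient_add_finrank_of_tower (K := K) (maximalIdeal C ^ j)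
  have h3 := finrank_quotient_add_finrank_of_tower (K := K) (maximalIdeal C ^ (j + 1))
  have h4 := ((Submodule.submoduleOfEquivOfLe
    (Ideal.pow_le_pow_right (I := maximalIdeal C) (Nat.le_succ j))).restrictScalars K).finrank_eq
  simp only [Nat.succ_eq_add_one] at h4
  unfold hilbertFunction
  omega

lemma finrank_quotient_maximalIdeal_pow {R C : Type*} [CommRing R] [Algebra K R] [CommRing C]
    [IsLocalRing C] [Algebra K C] {χ : R →ₐ[K] C} (hχ : Function.Surjective χ) {M : Ideal R}
    (hM : M.map χ = maximalIdeal C) (j : ℕ) :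
    Module.finrank K (C ⧸ maximalIdeal C ^ j) = Module.finrank K (R ⧸ (M ^ j ⊔ RingHom.ker χ)) := by
  let ψ : R →ₐ[K] C ⧸ maximalIdeal C ^ j := (Ideal.Quotient.mkₐ K _).comp χ
  have hψ : Function.Surjective ψ := (Ideal.Quotient.mkₐ_surjective K _).comp hχ
  have hker : RingHom.ker ψ = M ^ j ⊔ RingHom.ker χ := by
    have h1 : RingHom.ker ψ = (maximalIdeal C ^ j).comap χ := by
      ext r
      simp [ψ, RingHom.mem_ker, Ideal.Quotient.eq_zero_iff_mem]
    rw [h1, ← hM, ← Ideal.map_pow, Ideal.comap_map_of_surjective _ hχ]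
    rfl
  rw [← hker]
  exact (Ideal.quotientKerAlgEquivOfSurjective hψ).toLinearEquiv.finrank_eq.symm

/-- Multiplication by g has image (g) and kernel Ann(g), so dim Q/(g) = dim Ann(g). -/
lemma finrank_quotient_span_eq_of_forall_mul_eq_zero_iff {Q : Type*} [CommRing Q] [Algebra K Q]
    [Module.Finite K Q] {f h : Q} (hfh : ∀ r, r * f = 0 ↔ r * h = 0) :
    Module.finrank K (Q ⧸ Ideal.span {f}) = Module.finrank K (Q ⧸ Ideal.span {h}) := by
  have key : ∀ g : Q, Module.finrank K (Q ⧸ Ideal.span {g}) =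
      Module.finrank K (LinearMap.ker (LinearMap.mulRight K g)) := by
    intro g
    have h1 := finrank_quotient_add_finrank_of_tower (K := K) (Ideal.span {g})
    have h2 := (LinearMap.mulRight K g).finrank_range_add_finrank_ker
    have h3 : LinearMap.range (LinearMap.mulRight K g) =
        (Ideal.span {g}).restrictScalars K := by
      ext r
      simp [Ideal.mem_span_singleton']
    rw [h3] at h2
    have h4 : Module.finrank K ((Ideal.span {g}).restrictScalars K) =
      Module.finrank K (Ideal.span {g}) := rfl
    omega
  have hker : LinearMap.ker (LinearMap.mulRight K f) = LinearMap.ker (LinearMap.mulRight K h) := by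
    ext r
    simp [hfh]
  rw [key, key, hker]

lemma finrank_quotient_sup_span_eq {R : Type*} [CommRing R] [Algebra K R] {L : Ideal R}
    [Module.Finite K (R ⧸ L)] {f h : R} (hfh : ∀ r, r * f ∈ L ↔ r * h ∈ L) :
    Module.finrank K (R ⧸ (L ⊔ Ideal.span {f})) = Module.finrank K (R ⧸ (L ⊔ Ideal.span {h})) := by
  have key : ∀ g : R, Module.finrank K (R ⧸ (L ⊔ Ideal.span {g})) =
      Module.finrank K ((R ⧸ L) ⧸ Ideal.span {Ideal.Quotient.mk L g}) := by
    intro g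
    rw [← (DoubleQuot.quotQuotEquivQuotSupₐ K L (Ideal.span {g})).toLinearEquiv.finrank_eq,
      Ideal.map_span, Set.image_singleton]
    rfl
  rw [key, key]
  apply finrank_quotient_span_eq_of_forall_mul_eq_zero_iff
  intro r
  obtain ⟨r, rfl⟩ := Ideal.Quotient.mk_surjective r
  rw [← map_mul, ← map_mul, Ideal.Quotient.eq_zero_iff_mem, Ideal.Quotient.eq_zero_iff_mem, hfh]

lemma finite_of_surjective_of_isIntegral {T Q : Type*} [CommRing T] [CommRing Q] [Algebra T Q]
    {n : ℕ} {χ : MvPolynomial (Fin n) T →ₐ[T] Q} (hχ : Function.Surjective χ)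
    (hint : ∀ j, IsIntegral T (χ (X j))) : Module.Finite T Q := by
  have h1 : Algebra.FiniteType T Q := Algebra.FiniteType.of_surjective χ hχ
  have h2 : Algebra.IsIntegral T Q := by
    refine ⟨fun a => ?_⟩
    obtain ⟨r, rfl⟩ := hχ a
    induction r using MvPolynomial.induction_on with
    | C t =>
      have : χ (C t) = algebraMap T Q t := χ.commutes t
      rw [this]
      exact isIntegral_algebraMap
    | add p q hp hq => rw [map_add]; exact hp.add hq
    | mul_X p j hp => rw [map_mul]; exact hp.mul (hint j)
  exact Algebra.IsIntegral.finite

lemma isIntegral_of_pow_eq_zero {T Q : Type*} [CommRing T] [CommRing Q] [Algebra T Q] {a : Q}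
    {N : ℕ} (ha : a ^ N = 0) : IsIntegral T a :=
  ⟨Polynomial.X ^ N, Polynomial.monic_X_pow N, by simp [ha]⟩

lemma isIntegral_of_mul_sub_pow_eq_zero {T Q : Type*} [CommRing T] [CommRing Q] [Algebra T Q]
    {a : Q} {t : T} {k N : ℕ} (ha : (a ^ k * (a - algebraMap T Q t)) ^ N = 0) : IsIntegral T a :=
  ⟨(Polynomial.X ^ k * (Polynomial.X - Polynomial.C t)) ^ N,
    ((Polynomial.monic_X_pow _).mul (Polynomial.monic_X_sub_C _)).pow _, by simp [ha]⟩

variable {n : ℕ}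

lemma finite_quotient_of_pow_le {L : Ideal (MvPolynomial (Fin n) K)} {N : ℕ}
    (hL : idealOfVars (Fin n) K ^ N ≤ L) : Module.Finite K (MvPolynomial (Fin n) K ⧸ L) := by
  refine finite_of_surjective_of_isIntegral (Ideal.Quotient.mkₐ_surjective K L) fun j => ?_
  refine isIntegral_of_pow_eq_zero (N := N) ?_
  rw [← map_pow]
  exact Ideal.Quotient.eq_zero_iff_mem.mpr (hL (Ideal.pow_mem_pow (X_mem_idealOfVars j) _))

lemma idealOfVars_eq_ker :
    idealOfVars (Fin n) K = RingHom.ker (constantCoeff : MvPolynomial (Fin n) K →+* K) := by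
  apply le_antisymm
  · refine Ideal.span_le.mpr ?_
    rintro _ ⟨j, rfl⟩
    exact constantCoeff_X K j
  · intro r hr
    rw [← pow_one (idealOfVars (Fin n) K), mem_pow_idealOfVars_iff']
    intro x hx
    have : x = 0 := by
      rw [← Finsupp.degree_eq_zero_iff]; omega
    rw [this]
    exact hr

instance idealOfVars_isMaximal : (idealOfVars (Fin n) K).IsMaximal := by
  rw [idealOfVars_eq_ker]
  exact RingHom.ker_isMaximal_of_surjective _ fun a => ⟨C a, constantCoeff_C _ a⟩

/-- A prime ideal containing a power of M contains M. -/
lemma isLocalRing_quotient {L : Ideal (MvPolynomial (Fin n) K)} {N : ℕ}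
    (hL : idealOfVars (Fin n) K ^ N ≤ L) (hL' : L ≤ idealOfVars (Fin n) K) :
    ∃ _ : IsLocalRing (MvPolynomial (Fin n) K ⧸ L),
      (idealOfVars (Fin n) K).map (Ideal.Quotient.mkₐ K L) =
        maximalIdeal (MvPolynomial (Fin n) K ⧸ L) := by
  have hmax : ((idealOfVars (Fin n) K).map (Ideal.Quotient.mk L)).IsMaximal := by
    apply Ideal.IsMaximal.map_of_surjective_of_ker_le Ideal.Quotient.mk_surjective
    rwa [Ideal.mk_ker]
  have hloc : IsLocalRing (MvPolynomial (Fin n) K ⧸ L) := by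
    refine IsLocalRing.of_unique_max_ideal ⟨_, hmax, fun I hI => ?_⟩
    refine (hmax.eq_of_le hI.ne_top ?_).symm
    rw [Ideal.map_le_iff_le_comap]
    have : (I.comap (Ideal.Quotient.mk L)).IsPrime := Ideal.IsPrime.comap _
    refine Ideal.IsPrime.le_of_pow_le (n := N) (hL.trans ?_)
    intro r hr
    rw [Ideal.mem_comap, Ideal.Quotient.eq_zero_iff_mem.mpr hr]
    exact zero_mem _
  exact ⟨hloc, IsLocalRing.eq_maximalIdeal hmax⟩

end Dimension

/-! ### Fibres over nonzero parameters: splitting off a point -/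

section Fibres

variable {K : Type u} [Field K] {A : Type v} [CommRing A] [Algebra K A] {n : ℕ}

/-- The part of the kernel of a presentation that vanishes on the `i`-th axis. -/
def axisKer (φ : MvPolynomial (Fin n) K →ₐ[K] A) (i : Fin n) : Ideal (MvPolynomial (Fin n) K) :=
  RingHom.ker φ ⊓ axisIdeal i

/-- The equation `α_i^ν - a α_i^(ν-1) - q` of the fibre of the upper ray family over `a`. -/
def rayEquation (i : Fin n) (ν : ℕ) (q : MvPolynomial (Fin n) K) (a : K) :
    MvPolynomial (Fin n) K :=
  X i ^ ν - C a * X i ^ (ν - 1) - q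

variable {φ : MvPolynomial (Fin n) K →ₐ[K] A} {i : Fin n} {s ν : ℕ} {q : MvPolynomial (Fin n) K}

lemma rayEquation_zero : rayEquation i ν q 0 = X i ^ ν - q := by
  simp [rayEquation]

lemma mem_axisKer {r : MvPolynomial (Fin n) K} :
    r ∈ axisKer φ i ↔ φ r = 0 ∧ r ∈ axisIdeal i :=
  Iff.rfl

lemma axisKer_le_idealOfVars : axisKer φ i ≤ idealOfVars (Fin n) K :=
  inf_le_right.trans axisIdeal_le_idealOfVars

/-- M^(k+1) is (α_i^(k+1)) + P M^k, and J consists of the elements of P killed by φ. So membership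
is decided by the order of the axis part and by the image in A of the rest. -/
lemma mem_pow_sup_axisKer_iff (hφ : Function.Surjective φ) {k : ℕ} {u : MvPolynomial (Fin n) K} :
    u ∈ idealOfVars (Fin n) K ^ (k + 1) ⊔ axisKer φ i ↔
      Polynomial.X ^ (k + 1) ∣ axisProj i u ∧
      φ (u - axisIncl i (axisProj i u)) ∈ (axisIdeal i * idealOfVars (Fin n) K ^ k).map φ := by
  constructor
  · intro hu
    obtain ⟨m, hm, j, hj, rfl⟩ := Submodule.mem_sup.mp hu
    obtain ⟨hj1, hj2⟩ := mem_axisKer.mp hj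
    rw [mem_axisIdeal] at hj2
    have h1 : φ (m + j - axisIncl i (axisProj i (m + j))) =
        φ (m - axisIncl i (axisProj i m)) := by
      rw [map_add (axisProj i), hj2, add_zero, map_sub, map_add, hj1, add_zero, map_sub]
    rw [h1, map_add, hj2, add_zero]
    exact ⟨axisProj_mem_of_mem_pow hm, Ideal.mem_map_of_mem φ (sub_axisIncl_mem_mul hm)⟩
  · rintro ⟨⟨p, hp⟩, h2⟩
    obtain ⟨v, hv, hvu⟩ := (Ideal.mem_map_iff_of_surjective φ hφ).mp h2
    have hvP : v ∈ axisIdeal i := Ideal.mul_le_left hv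
    have hvM : v ∈ idealOfVars (Fin n) K ^ (k + 1) := by
      rw [pow_succ']
      exact Ideal.mul_mono_left axisIdeal_le_idealOfVars hv
    have h3 : u - axisIncl i (axisProj i u) - v ∈ axisKer φ i := by
      refine mem_axisKer.mpr ⟨?_, sub_mem (sub_axisIncl_mem u) hvP⟩
      rw [map_sub, hvu, sub_self]
    have h4 : u = (axisIncl i (axisProj i u) + v) + (u - axisIncl i (axisProj i u) - v) := by ring
    rw [h4]
    refine add_mem (Ideal.mem_sup_left (add_mem ?_ hvM)) (Ideal.mem_sup_right h3)
    rw [hp, map_mul, map_pow, axisIncl_X]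
    exact Ideal.mul_mem_right _ _ (Ideal.pow_mem_pow (X_mem_idealOfVars i) _)

namespace IsRayPresentation

lemma axisProj_q (h : IsRayPresentation φ i s ν q) : axisProj i q = 0 := h.q_mem

lemma map_X_pow_succ (h : IsRayPresentation φ i s ν q) : φ (X i) ^ (s + 1) = 0 := by
  rw [← map_pow]
  exact h.map_eq_zero_of_mem_pow _ (Ideal.pow_mem_pow (X_mem_idealOfVars i) _)

/-- Because x^(ν-1) kills 𝔟, multiplication by it sees only the restriction to the axis. -/
lemma map_X_pow_mul_eq (h : IsRayPresentation φ i s ν q) (r : MvPolynomial (Fin n) K) :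
    φ (X i ^ (ν - 1) * r) = φ (X i ^ (ν - 1) * axisIncl i (axisProj i r)) := by
  rw [← sub_eq_zero, ← map_sub, ← mul_sub]
  exact h.map_X_pow_mul _ (sub_axisIncl_mem r)

lemma X_pow_pred_mul_X (h : IsRayPresentation φ i s ν q) :
    (X i : MvPolynomial (Fin n) K) ^ (ν - 1) * X i = X i ^ ν := by
  rw [← pow_succ, Nat.sub_add_cancel (by have := h.two_le; omega)]

/-- The axis part of a relation is divisible by X^ν; the multiple of α_i^ν - q with the same axis
part can be subtracted, leaving an element of J. -/
lemma ker_eq (h : IsRayPresentation φ i s ν q) :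
    RingHom.ker φ = axisKer φ i ⊔ Ideal.span {X i ^ ν - q} := by
  apply le_antisymm
  · intro r hr
    obtain ⟨p, hp⟩ := h.dvd_of_map_eq_zero r hr
    rw [sup_comm, Ideal.mem_span_singleton_sup]
    refine ⟨axisIncl i p, r - axisIncl i p * (X i ^ ν - q), mem_axisKer.mpr ⟨?_, ?_⟩, by ring⟩
    · rw [RingHom.mem_ker] at hr
      rw [map_sub, hr, map_mul, map_sub, h.map_q, sub_self, mul_zero, sub_zero]
    · rw [mem_axisIdeal, map_sub, hp, map_mul, map_sub, axisProj_axisIncl, map_pow,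
        axisProj_X_self, h.axisProj_q]
      ring
  · refine sup_le inf_le_left ?_
    rw [Ideal.span_singleton_le_iff_mem, RingHom.mem_ker, map_sub, h.map_q, sub_self]

lemma exists_inverse (h : IsRayPresentation φ i s ν q) {a : K} (ha : a ≠ 0) :
    ∃ w : MvPolynomial (Fin n) K, φ w * (φ (X i) - algebraMap K A a) = 1 := by
  have hu : IsUnit (φ (X i) - algebraMap K A a) :=
    sub_eq_add_neg (φ (X i)) _ ▸ IsNilpotent.isUnit_add_right_of_commute
      ⟨s + 1, h.map_X_pow_succ⟩ (ha.isUnit.map (algebraMap K A)).neg (Commute.all _ _)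
  obtain ⟨b, hb⟩ := hu.exists_left_inv
  obtain ⟨w, rfl⟩ := h.surjective b
  exact ⟨w, hb⟩

variable {a : K} {w : MvPolynomial (Fin n) K}

/-- P/J embeds into A, where w inverts α_i - a. -/
lemma sub_mul_mem_axisKer (hw : φ w * (φ (X i) - algebraMap K A a) = 1)
    {r : MvPolynomial (Fin n) K} (hr : r ∈ axisIdeal i) :
    r - (X i - C a) * w * r ∈ axisKer φ i := by
  refine mem_axisKer.mpr ⟨?_, sub_mem hr (Ideal.mul_mem_left _ _ hr)⟩
  have hC : φ (C a) = algebraMap K A a := φ.commutes a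
  rw [map_sub, map_mul, map_mul, map_sub, hC, mul_comm _ (φ w), hw, one_mul,
    sub_self]

lemma sub_mul_sub_rayEquation_mem (h : IsRayPresentation φ i s ν q)
    (hw : φ w * (φ (X i) - algebraMap K A a) = 1) :
    (X i - C a) * (X i ^ (ν - 1) - w * q) - rayEquation i ν q a ∈ axisKer φ i := by
  have := sub_mul_mem_axisKer hw h.q_mem
  have h2 : (X i - C a) * (X i ^ (ν - 1) - w * q) - rayEquation i ν q a =
      q - (X i - C a) * w * q := by
    rw [rayEquation, ← h.X_pow_pred_mul_X]; ring
  rwa [h2]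

/-- The two ray equations have the same annihilator modulo `M ^ (k + 1)` for `k < s`. -/
lemma mul_mem_pow_sup_iff (h : IsRayPresentation φ i s ν q)
    (hw : φ w * (φ (X i) - algebraMap K A a) = 1) {k : ℕ} (hk : k < s)
    (r : MvPolynomial (Fin n) K) :
    r * (X i ^ ν - q) ∈ idealOfVars (Fin n) K ^ (k + 1) ⊔ axisKer φ i ↔
      r * (X i ^ (ν - 1) - w * q) ∈ idealOfVars (Fin n) K ^ (k + 1) ⊔ axisKer φ i := by
  rw [mem_pow_sup_axisKer_iff h.surjective, mem_pow_sup_axisKer_iff h.surjective]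
  set I := (axisIdeal i * idealOfVars (Fin n) K ^ k).map φ
  set p := axisProj i r
  have hwu : IsUnit (φ w) := IsUnit.of_mul_eq_one _ hw
  have e1 : axisProj i (r * (X i ^ ν - q)) = p * Polynomial.X ^ ν := by
    rw [map_mul, map_sub, h.axisProj_q, map_pow, axisProj_X_self, sub_zero]
  have e2 : axisProj i (r * (X i ^ (ν - 1) - w * q)) = p * Polynomial.X ^ (ν - 1) := by
    rw [map_mul, map_sub, map_mul, h.axisProj_q, map_pow, axisProj_X_self, mul_zero, sub_zero]
  set y := φ (axisIncl i p * X i ^ ν) with hy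
  have e3 : φ (r * (X i ^ ν - q) - axisIncl i (p * Polynomial.X ^ ν)) = - y := by
    rw [map_sub, map_mul, map_sub, h.map_q, sub_self, mul_zero, map_mul (axisIncl i), map_pow,
      axisIncl_X, zero_sub]
  have e4 : φ (r * (X i ^ (ν - 1) - w * q) - axisIncl i (p * Polynomial.X ^ (ν - 1))) =
      - φ w * y := by
    have h1 : φ (r * (X i ^ (ν - 1) - w * q)) =
        φ (X i ^ (ν - 1) * r) * (1 - φ w * φ (X i)) := by
      simp only [map_mul, map_sub, h.map_q, ← h.X_pow_pred_mul_X]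
      ring
    rw [map_sub, h1, h.map_X_pow_mul_eq, hy, ← h.X_pow_pred_mul_X]
    simp only [map_mul, map_pow, axisIncl_X]
    ring
  -- The parts off the axis map to -y and -φ(w)y, which differ by a unit. What remains is
  -- divisibility by X^(k+1) of p X^ν against p X^(ν-1).
  rw [e1, e2, e3, e4, neg_mul, neg_mem_iff, neg_mem_iff, Ideal.unit_mul_mem_iff_mem _ hwu]
  have hν := h.two_le
  constructor
  · rintro ⟨h1, h2⟩
    refine ⟨?_, h2⟩
    by_cases hp0 : p = 0
    · rw [hp0, zero_mul]
      exact dvd_zero _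
    obtain ⟨l, p', hl, hp'⟩ := exists_eq_X_pow_mul_of_ne_zero hp0
    have hdvd : ∀ m e, Polynomial.X ^ e ∣ p * Polynomial.X ^ m ↔ e ≤ l + m := by
      intro m e
      have : p * Polynomial.X ^ m = p' * Polynomial.X ^ (l + m) := by rw [hl, pow_add]; ring
      rw [this]
      constructor
      · intro hd
        by_contra hlt
        refine hp' ?_
        obtain ⟨g, hg⟩ := hd
        have := congrArg (fun f => Polynomial.coeff f (l + m)) hg
        simp only [Polynomial.coeff_mul_X_pow', le_refl, if_true, Nat.sub_self] at this
        rw [this, mul_comm, Polynomial.coeff_mul_X_pow', if_neg (by omega)]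
      · intro hle
        exact Dvd.dvd.mul_left (pow_dvd_pow _ hle) _
    rw [hdvd] at h1 ⊢
    -- The only critical order is ord p + ν = k + 1. Then y is x^(k+1) times a unit, and `notMem`
    -- keeps it out of 𝔟𝔫^k.
    by_contra hlt
    have hlk : l + ν = k + 1 := by omega
    apply h.notMem k hk
    have h3 : y = φ (X i ^ (k + 1)) * Polynomial.aeval (φ (X i)) p' := by
      rw [hy, hl, ← hlk, Polynomial.aeval_algHom_apply]
      simp only [map_mul, map_pow, axisIncl_X, pow_add]
      rw [axisIncl]
      ring
    rw [h3] at h2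
    exact (Ideal.mul_unit_mem_iff_mem _
      (isUnit_aeval_of_isNilpotent ⟨s + 1, h.map_X_pow_succ⟩ hp')).mp h2
  · rintro ⟨h1, h2⟩
    exact ⟨h1.trans (mul_dvd_mul_left _ (pow_dvd_pow _ (Nat.sub_le _ _))), h2⟩

lemma finrank_quotient_eq (h : IsRayPresentation φ i s ν q)
    (hw : φ w * (φ (X i) - algebraMap K A a) = 1) {j : ℕ} (hj : j ≤ s) :
    Module.finrank K (MvPolynomial (Fin n) K ⧸ (idealOfVars (Fin n) K ^ j ⊔ RingHom.ker φ)) =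
      Module.finrank K (MvPolynomial (Fin n) K ⧸ (idealOfVars (Fin n) K ^ j ⊔
        (axisKer φ i ⊔ Ideal.span {X i ^ (ν - 1) - w * q}))) := by
  cases j with
  | zero => rw [pow_zero, Ideal.one_eq_top, top_sup_eq, top_sup_eq]
  | succ k =>
    have := finite_quotient_of_pow_le (K := K) (n := n)
      (le_sup_left : _ ≤ idealOfVars (Fin n) K ^ (k + 1) ⊔ axisKer φ i)
    rw [h.ker_eq, ← sup_assoc, ← sup_assoc]
    exact finrank_quotient_sup_span_eq (h.mul_mem_pow_sup_iff hw (by omega))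

/-- This is where B loses one socle degree. Modulo the last generator, α_i^s is α_i^(s+1-ν) w q, an
element of P mapping to a multiple of x^(s+1) = 0; the rest of M^s lies in P M^(s-1), hence in J. -/
lemma pow_le_axisKer_sup (h : IsRayPresentation φ i s ν q)
    (w : MvPolynomial (Fin n) K) : idealOfVars (Fin n) K ^ s ≤
    axisKer φ i ⊔ Ideal.span {X i ^ (ν - 1) - w * q} := by
  have hs := h.pos
  have hν := h.two_le
  have hνs := h.le_succ
  obtain ⟨k, rfl⟩ : ∃ k, s = k + 1 := ⟨s - 1, by omega⟩
  refine (idealOfVars_pow_succ_le (i := i) k).trans (sup_le ?_ ?_)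
  · rw [Ideal.span_singleton_le_iff_mem]
    have h1 : (X i : MvPolynomial (Fin n) K) ^ (k + 1) =
        X i ^ (k + 2 - ν) * w * q + X i ^ (k + 2 - ν) * (X i ^ (ν - 1) - w * q) := by
      have : k + 1 = (k + 2 - ν) + (ν - 1) := by omega
      nth_rewrite 1 [this]
      rw [pow_add]
      ring
    rw [h1]
    refine add_mem (Ideal.mem_sup_left (mem_axisKer.mpr ⟨?_, Ideal.mul_mem_left _ _ h.q_mem⟩))
      (Ideal.mem_sup_right (Ideal.mul_mem_left _ _ (Ideal.mem_span_singleton_self _)))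
    rw [map_mul, h.map_q, map_mul, mul_right_comm, ← map_mul, ← pow_add,
      show k + 2 - ν + ν = k + 1 + 1 by omega, map_pow, h.map_X_pow_succ, zero_mul]
  · refine le_sup_of_le_left fun r hr =>
      mem_axisKer.mpr ⟨h.map_eq_zero_of_mem_mul r hr, Ideal.mul_le_left hr⟩

lemma axisKer_sup_le (h : IsRayPresentation φ i s ν q) (w : MvPolynomial (Fin n) K) :
    axisKer φ i ⊔ Ideal.span {X i ^ (ν - 1) - w * q} ≤ idealOfVars (Fin n) K := by
  refine sup_le axisKer_le_idealOfVars ?_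
  rw [Ideal.span_singleton_le_iff_mem]
  refine sub_mem ?_ (Ideal.mul_mem_left _ _ (axisIdeal_le_idealOfVars h.q_mem))
  exact Ideal.pow_mem_of_mem _ (X_mem_idealOfVars i) _ (by have := h.two_le; omega)

/-- Let g = α_i^(ν-1) - wq, with value a^(ν-1) ≠ 0 at the point. If kg + j with j ∈ J vanishes
there, so does k. Its axis part is then a multiple of α_i - a, and so is its part in P modulo J.
Hence kg is a multiple of (α_i - a)g, which is the fibre equation modulo J. -/
lemma ker_prod_eq (h : IsRayPresentation φ i s ν q)
    (ha : a ≠ 0) (hw : φ w * (φ (X i) - algebraMap K A a) = 1) :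
    RingHom.ker (((Polynomial.aeval a).comp (axisProj i)).prod
      (Ideal.Quotient.mkₐ K (axisKer φ i ⊔ Ideal.span {X i ^ (ν - 1) - w * q}))) =
      axisKer φ i ⊔ Ideal.span {rayEquation i ν q a} := by
  have hh := h.sub_mul_sub_rayEquation_mem hw
  set g := X i ^ (ν - 1) - w * q with hg
  have hmem : ∀ r, r ∈ RingHom.ker (((Polynomial.aeval a).comp (axisProj i)).prod
      (Ideal.Quotient.mkₐ K (axisKer φ i ⊔ Ideal.span {g}))) ↔
      (axisProj i r).eval a = 0 ∧ r ∈ axisKer φ i ⊔ Ideal.span {g} := by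
    intro r
    rw [RingHom.mem_ker]
    simp only [AlgHom.prod_apply, Prod.mk_eq_zero, AlgHom.comp_apply,
      Ideal.Quotient.mkₐ_eq_mk, Ideal.Quotient.eq_zero_iff_mem, Polynomial.coe_aeval_eq_eval]
  have hJ0 : ∀ r ∈ axisKer φ i, axisProj i r = 0 := fun r hr =>
    mem_axisIdeal.mp (mem_axisKer.mp hr).2
  have hge : (axisProj i g).eval a = a ^ (ν - 1) := by
    simp [hg, h.axisProj_q]
  have hν := h.two_le
  apply le_antisymm
  · intro r hr
    obtain ⟨h0, hr⟩ := (hmem r).mp hr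
    rw [sup_comm, Ideal.mem_span_singleton_sup] at hr
    obtain ⟨k, j, hj, rfl⟩ := hr
    rw [map_add, hJ0 j hj, add_zero, map_mul, Polynomial.eval_mul, hge] at h0
    have hk : (axisProj i k).IsRoot a :=
      (mul_eq_zero.mp h0).resolve_right (pow_ne_zero _ ha)
    obtain ⟨p, hp⟩ := Polynomial.dvd_iff_isRoot.mpr hk
    have hk1 := sub_mul_mem_axisKer hw (sub_axisIncl_mem (i := i) k)
    have hCa : axisIncl i (Polynomial.C a) = C a := (axisIncl i).commutes a
    have hk2 : axisIncl i (axisProj i k) = (X i - C a) * axisIncl i p := by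
      rw [hp, map_mul, map_sub, axisIncl_X, hCa]
    set k0 := k - axisIncl i (axisProj i k) with hk0
    have h5 : k * g + j = (axisIncl i p + w * k0) * rayEquation i ν q a +
        ((k0 - (X i - C a) * w * k0) * g + (axisIncl i p + w * k0) *
          ((X i - C a) * g - rayEquation i ν q a) + j) := by
      have : k = k0 + (X i - C a) * axisIncl i p := by rw [← hk2, hk0]; ring
      rw [this]
      ring
    rw [h5, sup_comm, Ideal.mem_span_singleton_sup]
    exact ⟨_, _, add_mem (add_mem (Ideal.mul_mem_right _ _ hk1) (Ideal.mul_mem_left _ _ hh)) hj,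
      rfl⟩
  · refine sup_le ?_ ?_
    · intro r hr
      rw [hmem, hJ0 r hr, Polynomial.eval_zero]
      exact ⟨rfl, Ideal.mem_sup_left hr⟩
    · rw [Ideal.span_singleton_le_iff_mem, hmem]
      constructor
      · have : axisProj i (C a : MvPolynomial (Fin n) K) = Polynomial.C a := (axisProj i).commutes a
        rw [rayEquation, ← h.X_pow_pred_mul_X]
        simp [h.axisProj_q, this]
        ring
      · have h6 : rayEquation i ν q a =
            -((X i - C a) * g - rayEquation i ν q a) + (X i - C a) * g := by ring
        rw [h6]
        exact add_mem (Ideal.mem_sup_left (neg_mem hh))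
          (Ideal.mem_sup_right (Ideal.mul_mem_left _ _ (Ideal.mem_span_singleton_self _)))

lemma prod_surjective (h : IsRayPresentation φ i s ν q) (ha : a ≠ 0) (w : MvPolynomial (Fin n) K) :
    Function.Surjective (((Polynomial.aeval a).comp (axisProj i)).prod
      (Ideal.Quotient.mkₐ K (axisKer φ i ⊔ Ideal.span {X i ^ (ν - 1) - w * q}))) := by
  rintro ⟨b, r⟩
  obtain ⟨r, rfl⟩ := Ideal.Quotient.mk_surjective r
  have hC : ∀ t : K, axisProj i (C t : MvPolynomial (Fin n) K) = Polynomial.C t :=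
    (axisProj i).commutes
  -- The added generator is zero in the second factor and has value a^(ν-1) ≠ 0 at the point, so it
  -- adjusts the first coordinate alone.
  refine ⟨r + C ((b - (axisProj i r).eval a) / a ^ (ν - 1)) * (X i ^ (ν - 1) - w * q), ?_⟩
  refine Prod.ext ?_ ?_
  · simp [h.axisProj_q, hC, ha]
  · refine Ideal.Quotient.eq.mpr ?_
    rw [add_sub_cancel_left]
    exact Ideal.mem_sup_right (Ideal.mul_mem_left _ _ (Ideal.mem_span_singleton_self _))

/-- The part of the fibre over `a ≠ 0` that is supported at the origin. -/
theorem exists_local_factor [IsLocalRing A] [Module.Finite K A]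
    (h : IsRayPresentation φ i s ν q) (hM : (idealOfVars (Fin n) K).map φ = maximalIdeal A)
    {a : K} (ha : a ≠ 0) :
    ∃ (B : Type u) (_ : CommRing B) (_ : IsLocalRing B) (_ : Algebra K B) (_ : Module.Finite K B),
      IsSocleDegree B (s - 1) ∧
      (∀ j, j ≤ s - 1 → hilbertFunction K B j = hilbertFunction K A j) ∧
      ∃ χ : MvPolynomial (Fin n) K →ₐ[K] K × B, Function.Surjective χ ∧
        RingHom.ker χ = axisKer φ i ⊔ Ideal.span {rayEquation i ν q a} ∧
        ∀ j, (χ (X j)).1 = (if j = i then a else 0) ∧ (χ (X j)).2 ∈ maximalIdeal B := by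
  obtain ⟨w, hw⟩ := h.exists_inverse ha
  have hs := h.pos
  set L := axisKer φ i ⊔ Ideal.span {X i ^ (ν - 1) - w * q}
  have hfin := finite_quotient_of_pow_le (h.pow_le_axisKer_sup w)
  obtain ⟨hloc, hmax⟩ := isLocalRing_quotient (h.pow_le_axisKer_sup w) (h.axisKer_sup_le w)
  have hH : ∀ j, j ≤ s - 1 →
      hilbertFunction K (MvPolynomial (Fin n) K ⧸ L) j = hilbertFunction K A j := by
    have hdim : ∀ j ≤ s, Module.finrank K ((MvPolynomial (Fin n) K ⧸ L) ⧸
        maximalIdeal (MvPolynomial (Fin n) K ⧸ L) ^ j) =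
        Module.finrank K (A ⧸ maximalIdeal A ^ j) := by
      intro j hj
      rw [finrank_quotient_maximalIdeal_pow (Ideal.Quotient.mkₐ_surjective K L) hmax,
        finrank_quotient_maximalIdeal_pow h.surjective hM, h.finrank_quotient_eq hw hj,
        show RingHom.ker (Ideal.Quotient.mkₐ K L) = L from Ideal.Quotient.mkₐ_ker K L]
    intro j hj
    have h1 := hilbertFunction_add_finrank (K := K) (C := MvPolynomial (Fin n) K ⧸ L) j
    have h2 := hilbertFunction_add_finrank (K := K) (C := A) j
    rw [hdim _ (by omega), hdim _ (by omega)] at h1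
    omega
  refine ⟨MvPolynomial (Fin n) K ⧸ L, inferInstance, hloc, inferInstance, hfin, ⟨?_, ?_⟩, hH,
    _, h.prod_surjective ha w, h.ker_prod_eq ha hw, fun j => ⟨?_, ?_⟩⟩
  -- Otherwise H_A(s-1) = H_B(s-1) = 0, so x^(s-1) ∈ 𝔫^s and x^s ∈ 𝔫^(s+1) = 0, against `notMem`.
  · intro h0
    have h1 := hH (s - 1) le_rfl
    have hsub : Subsingleton ↥(maximalIdeal (MvPolynomial (Fin n) K ⧸ L) ^ (s - 1)) := by
      rw [h0]
      infer_instance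
    have h2 : hilbertFunction K (MvPolynomial (Fin n) K ⧸ L) (s - 1) = 0 :=
      Module.finrank_zero_of_subsingleton
    rw [h2] at h1
    have hfinA := finite_submodule_of_tower (K := K) (maximalIdeal A ^ (s - 1))
    have h3 := Submodule.Quotient.subsingleton_iff.mp
      (Module.finrank_zero_iff (R := K).mp h1.symm)
    have hmem : φ (X i) ∈ maximalIdeal A := hM ▸ Ideal.mem_map_of_mem φ (X_mem_idealOfVars i)
    have h4 : (⟨φ (X i) ^ (s - 1), Ideal.pow_mem_pow hmem _⟩ : ↥(maximalIdeal A ^ (s - 1))) ∈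
        (maximalIdeal A ^ (s - 1 + 1)).submoduleOf (maximalIdeal A ^ (s - 1)) := by
      rw [h3]
      trivial
    have h5 : φ (X i) ^ (s - 1) ∈ maximalIdeal A ^ (s - 1 + 1) := h4
    have h6 := Ideal.mul_mem_mul h5 hmem
    have h7 : maximalIdeal A ^ (s + 1) = ⊥ := by
      rw [eq_bot_iff, ← hM, ← Ideal.map_pow, Ideal.map_le_iff_le_comap]
      exact fun r hr => h.map_eq_zero_of_mem_pow r hr
    rw [← pow_succ, ← pow_succ, Nat.sub_add_cancel hs, h7, Ideal.mem_bot] at h6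
    refine h.notMem (s - 1) (by omega) ?_
    rw [Nat.sub_add_cancel hs, map_pow, h6]
    exact zero_mem _
  · intro k hk
    by_contra hlt
    apply hk
    rw [eq_bot_iff, ← hmax, ← Ideal.map_pow, Ideal.map_le_iff_le_comap]
    intro r hr
    exact Ideal.Quotient.eq_zero_iff_mem.mpr
      (h.pow_le_axisKer_sup w (Ideal.pow_le_pow_right (by omega) hr))
  · by_cases hj : j = i
    · subst hj; simp
    · simp [axisProj_X_of_ne hj, hj]
  · rw [← hmax]
    exact Ideal.mem_map_of_mem _ (X_mem_idealOfVars j)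

end IsRayPresentation

end Fibres

/-! ### Torsion-freeness of the family over K[t] -/

section TorsionFree

variable {K : Type u} [Field K] {A : Type v} [CommRing A] [Algebra K A] {n : ℕ}
  {φ : MvPolynomial (Fin n) K →ₐ[K] A} {i : Fin n} {s ν : ℕ} {q : MvPolynomial (Fin n) K}

/-- After scaling c is monic, hence not a zero divisor over any ring. -/
lemma eq_zero_of_map_mul_eq_zero {c : Polynomial K} (hc : c ≠ 0) {p : Polynomial A}
    (h : c.map (algebraMap K A) * p = 0) : p = 0 := by
  have hm := (Polynomial.monic_mul_leadingCoeff_inv hc).map (algebraMap K A)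
  rw [← hm.mul_right_eq_zero_iff, Polynomial.map_mul, mul_right_comm, h, zero_mul]

lemma mem_map_C_axisKer {m : Polynomial (MvPolynomial (Fin n) K)} :
    m ∈ (axisKer φ i).map Polynomial.C ↔
      m.map (φ : MvPolynomial (Fin n) K →+* A) = 0 ∧
      m.map (axisProj (K := K) i : MvPolynomial (Fin n) K →+* Polynomial K) = 0 := by
  rw [Ideal.mem_map_C_iff]
  simp only [mem_axisKer, mem_axisIdeal, forall_and, Polynomial.ext_iff, Polynomial.coeff_map,
    Polynomial.coeff_zero, RingHom.coe_coe]

/-- In K[x][t] the elements x and t - x are prime, and neither divides a nonzero polynomial in t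
alone. -/
lemma dvd_of_map_mul_eq {c : Polynomial K} (hc : c ≠ 0) {k : ℕ}
    {y v : Polynomial (Polynomial K)}
    (h : c.map Polynomial.C * y =
      v * (Polynomial.C Polynomial.X ^ k * (Polynomial.X - Polynomial.C Polynomial.X))) :
    ∃ y', y = y' * (Polynomial.C Polynomial.X ^ k * (Polynomial.X - Polynomial.C Polynomial.X)) ∧
      v = c.map Polynomial.C * y' := by
  have hp1 : Prime (Polynomial.C Polynomial.X : Polynomial (Polynomial K)) :=
    Polynomial.prime_C_iff.mpr Polynomial.prime_X
  have hp2 : Prime (Polynomial.X - Polynomial.C Polynomial.X : Polynomial (Polynomial K)) :=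
    Polynomial.prime_X_sub_C _
  have hn1 : ¬ (Polynomial.C Polynomial.X : Polynomial (Polynomial K)) ∣ c.map Polynomial.C := by
    rw [Polynomial.C_dvd_iff_dvd_coeff]
    intro hd
    apply hc
    ext k
    have := hd k
    rwa [Polynomial.coeff_map, Polynomial.X_dvd_iff, Polynomial.coeff_C_zero] at this
  have hn2 : ¬ (Polynomial.X - Polynomial.C Polynomial.X : Polynomial (Polynomial K)) ∣
      c.map Polynomial.C := by
    rw [Polynomial.dvd_iff_isRoot, Polynomial.IsRoot, Polynomial.eval_map, Polynomial.eval₂_C_X]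
    exact hc
  have hd1 : Polynomial.C Polynomial.X ^ k ∣ c.map Polynomial.C * y := by
    rw [h]
    exact Dvd.dvd.mul_left (dvd_mul_right _ _) _
  obtain ⟨y1, rfl⟩ := hp1.pow_dvd_of_dvd_mul_left k hn1 hd1
  have h1 : c.map Polynomial.C * y1 = v * (Polynomial.X - Polynomial.C Polynomial.X) := by
    apply mul_left_cancel₀ (pow_ne_zero k hp1.ne_zero)
    linear_combination h
  have hd2 : (Polynomial.X - Polynomial.C Polynomial.X) ∣ c.map Polynomial.C * y1 := by
    rw [h1]
    exact dvd_mul_left _ _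
  obtain ⟨y', rfl⟩ := (hp2.dvd_or_dvd hd2).resolve_left hn2
  refine ⟨y', by ring, ?_⟩
  apply mul_right_cancel₀ hp2.ne_zero
  linear_combination -h1

/-- The equation of the upper ray family as a polynomial in `t` over `K[α_1, …, α_n]`. -/
def familyEquation (i : Fin n) (ν : ℕ) (q : MvPolynomial (Fin n) K) :
    Polynomial (MvPolynomial (Fin n) K) :=
  Polynomial.C (X i) ^ ν - Polynomial.X * Polynomial.C (X i) ^ (ν - 1) - Polynomial.C q

lemma IsRayPresentation.mem_of_map_mul_mem (h : IsRayPresentation φ i s ν q) {c : Polynomial K}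
    (hc : c ≠ 0) {m : Polynomial (MvPolynomial (Fin n) K)}
    (hm : c.map C * m ∈
      (axisKer φ i).map Polynomial.C ⊔ Ideal.span {familyEquation i ν q}) :
    m ∈ (axisKer φ i).map Polynomial.C ⊔ Ideal.span {familyEquation i ν q} := by
  set u := familyEquation i ν q with hu
  let Φ := Polynomial.mapRingHom (φ : MvPolynomial (Fin n) K →+* A)
  let Pr := Polynomial.mapRingHom (axisProj (K := K) i : MvPolynomial (Fin n) K →+* Polynomial K)
  let E := Polynomial.mapRingHom (axisIncl (K := K) i : Polynomial K →+* MvPolynomial (Fin n) K)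
  have hmem : ∀ r, r ∈ (axisKer φ i).map Polynomial.C ↔ Φ r = 0 ∧ Pr r = 0 :=
    fun r => mem_map_C_axisKer
  have hΦX : ∀ r, Φ (Polynomial.C r) = Polynomial.C (φ r) := fun r => Polynomial.map_C _
  have hPrX : ∀ r, Pr (Polynomial.C r) = Polynomial.C (axisProj i r) := fun r => Polynomial.map_C _
  have hΦt : Φ Polynomial.X = Polynomial.X := Polynomial.map_X _
  have hPrt : Pr Polynomial.X = Polynomial.X := Polynomial.map_X _
  have hPrE : ∀ y, Pr (E y) = y := fun y => by
    ext1 k; simp [Pr, E]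
  have hΦc : Φ (c.map C) = c.map (algebraMap K A) := by
    ext k; simp [Φ, ← MvPolynomial.algebraMap_eq]
  have hPrc : Pr (c.map C) = c.map Polynomial.C := by
    ext1 k; simp [Pr, ← MvPolynomial.algebraMap_eq, ← Polynomial.algebraMap_eq]
  have hEc : E (c.map Polynomial.C) = c.map C := by
    ext1 k
    simp only [E, Polynomial.coe_mapRingHom, Polynomial.coeff_map, RingHom.coe_coe]
    exact (axisIncl i).commutes _
  have hΦu : Φ u = - (Polynomial.X * Polynomial.C (φ (X i ^ (ν - 1)))) := by
    simp only [hu, familyEquation, map_sub, map_mul, map_pow, hΦX, hΦt, h.map_q]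
    ring
  have hPru : Pr u = - (Polynomial.C Polynomial.X ^ (ν - 1) *
      (Polynomial.X - Polynomial.C Polynomial.X)) := by
    have hν : ν = ν - 1 + 1 := by have := h.two_le; omega
    simp only [hu, familyEquation, map_sub, map_mul, map_pow, hPrX, hPrt, axisProj_X_self,
      h.axisProj_q, map_zero]
    nth_rewrite 1 [hν]
    ring
  -- The image of u in A[t] is -t x^(ν-1), which kills 𝔟[t], so only the axis part of v counts.
  have hEP : ∀ v, Φ v * Φ u = Φ (E (Pr v)) * Φ u := by
    intro v
    have : Φ v * Polynomial.C (φ (X i ^ (ν - 1))) =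
        Φ (E (Pr v)) * Polynomial.C (φ (X i ^ (ν - 1))) := by
      ext k
      simp only [Polynomial.coeff_mul_C, Φ, E, Pr, Polynomial.coe_mapRingHom, Polynomial.coeff_map,
        RingHom.coe_coe]
      rw [mul_comm, ← map_mul, h.map_X_pow_mul_eq, map_mul, mul_comm]
    rw [hΦu]
    linear_combination (-Polynomial.X) * this
  rw [sup_comm, Ideal.mem_span_singleton_sup] at hm
  obtain ⟨v, j, hj, hvj⟩ := hm
  obtain ⟨hj1, hj2⟩ := (hmem j).mp hj
  have h1 : c.map (algebraMap K A) * Φ m = Φ v * Φ u := by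
    rw [← hΦc, ← map_mul, ← hvj, map_add, hj1, add_zero, map_mul]
  have h2 : c.map Polynomial.C * Pr m = Pr (-v) * (Polynomial.C Polynomial.X ^ (ν - 1) *
      (Polynomial.X - Polynomial.C Polynomial.X)) := by
    rw [← hPrc, ← map_mul, ← hvj, map_add, hj2, add_zero, map_mul, hPru, map_neg]
    ring
  obtain ⟨y, hy1, hy2⟩ := dvd_of_map_mul_eq hc h2
  -- The axis part of v is -c y, so v may be replaced by -c E(y) in A[t], and c cancels there; on
  -- the axis the sum is zero by the choice of y.
  have hm' : m + E y * u ∈ (axisKer φ i).map Polynomial.C := by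
    rw [hmem]
    constructor
    · apply eq_zero_of_map_mul_eq_zero hc
      have h3 : c.map (algebraMap K A) * Φ (E y) = - Φ (E (Pr v)) := by
        rw [← hΦc, ← map_mul Φ, ← hEc, ← map_mul E, ← hy2, map_neg, map_neg, map_neg]
      rw [map_add, map_mul]
      linear_combination h1 + hEP v + Φ u * h3
    · rw [map_add, map_mul, hPrE, hPru, hy1]
      ring
  rw [sup_comm, Ideal.mem_span_singleton_sup]
  exact ⟨-E y, _, hm', by ring⟩

end TorsionFree

/-! ### The upper ray family: finiteness, flatness, fibres -/

section Family

variable {K : Type u} [Field K] {A : Type v} [CommRing A] [Algebra K A] {n : ℕ}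
  {φ : MvPolynomial (Fin n) K →ₐ[K] A} {i : Fin n} {s : ℕ}
  {I : Ideal (MvPowerSeries (Fin n) K)} {D : RayDecomposition I i}

lemma map_C_mem_upperRayIdeal (hJ : D.polyJ = axisKer φ i) {r : MvPolynomial (Fin n) K}
    (hr : r ∈ axisKer φ i) :
    MvPolynomial.map (Polynomial.C : K →+* Polynomial K) r ∈ D.upperRayIdeal :=
  Ideal.mem_sup_left (Ideal.mem_map_of_mem _ (hJ ▸ hr))

lemma equation_mem_upperRayIdeal (D : RayDecomposition I i) :
    X i ^ D.ν - C Polynomial.X * X i ^ (D.ν - 1) - MvPolynomial.map Polynomial.C D.q ∈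
      D.upperRayIdeal :=
  Ideal.mem_sup_right (Ideal.mem_span_singleton_self _)

/-- Elements of P are nilpotent modulo J. This covers the other coordinates and also q =
α_i^(ν-1)(α_i - t), whose power gives a monic equation for α_i over K[t]. -/
theorem finite_upperRayFamily (h : IsRayPresentation φ i s D.ν D.q)
    (hJ : D.polyJ = axisKer φ i) : Module.Finite (Polynomial K) D.UpperRayFamily := by
  have hpow : ∀ r ∈ axisIdeal i, r ^ (s + 1) ∈ axisKer φ i := fun r hr =>
    mem_axisKer.mpr ⟨h.map_eq_zero_of_mem_pow _ (Ideal.pow_mem_pow (axisIdeal_le_idealOfVars hr) _),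
      Ideal.pow_mem_of_mem _ hr _ (Nat.succ_pos s)⟩
  refine finite_of_surjective_of_isIntegral (T := Polynomial K) (Q := D.UpperRayFamily)
    (χ := Ideal.Quotient.mkₐ (Polynomial K) D.upperRayIdeal)
    (Ideal.Quotient.mkₐ_surjective (Polynomial K) D.upperRayIdeal) fun j => ?_
  by_cases hj : j = i
  · subst hj
    have h1 : (Ideal.Quotient.mk D.upperRayIdeal) (X j ^ (D.ν - 1) * (X j - C Polynomial.X)) =
        Ideal.Quotient.mk D.upperRayIdeal (MvPolynomial.map Polynomial.C D.q) := by
      refine Ideal.Quotient.eq.mpr ?_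
      have hν : D.ν = D.ν - 1 + 1 := by have := h.two_le; omega
      have h2 := equation_mem_upperRayIdeal D
      nth_rewrite 1 [hν] at h2
      convert h2 using 1
      ring
    have h3 : Ideal.Quotient.mk D.upperRayIdeal
        (MvPolynomial.map (Polynomial.C : K →+* Polynomial K) D.q) ^ (s + 1) = 0 := by
      rw [← map_pow, ← map_pow]
      exact Ideal.Quotient.eq_zero_iff_mem.mpr (map_C_mem_upperRayIdeal hJ (hpow _ h.q_mem))
    rw [← h1, map_mul, map_pow, map_sub] at h3
    exact isIntegral_of_mul_sub_pow_eq_zero (T := Polynomial K) (Q := D.UpperRayFamily)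
      (t := Polynomial.X) h3
  · refine isIntegral_of_pow_eq_zero (T := Polynomial K) (Q := D.UpperRayFamily)
      (N := s + 1) ?_
    rw [← map_pow]
    refine Ideal.Quotient.eq_zero_iff_mem.mpr ?_
    have := map_C_mem_upperRayIdeal hJ (hpow _ (X_mem_axisIdeal hj))
    rwa [map_pow, map_X] at this

theorem flat_upperRayFamily (h : IsRayPresentation φ i s D.ν D.q)
    (hJ : D.polyJ = axisKer φ i) : D.IsUpperRayDegeneration := by
  -- θ and η pass between K[t][α] and K[α][t]; the torsion argument lives in the latter.
  let θ : MvPolynomial (Fin n) (Polynomial K) →+* Polynomial (MvPolynomial (Fin n) K) :=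
    eval₂Hom (Polynomial.mapRingHom C) (fun j => Polynomial.C (X j))
  let η : Polynomial (MvPolynomial (Fin n) K) →+* MvPolynomial (Fin n) (Polynomial K) :=
    Polynomial.eval₂RingHom (MvPolynomial.map Polynomial.C) (C Polynomial.X)
  have hηθ : ∀ g, η (θ g) = g := by
    have : η.comp θ = RingHom.id _ := by
      ext <;> simp [η, θ]
    exact fun g => DFunLike.congr_fun this g
  have hθC : ∀ r, θ (MvPolynomial.map Polynomial.C r) = Polynomial.C r := by
    have : θ.comp (MvPolynomial.map Polynomial.C) = Polynomial.C := by
      apply MvPolynomial.ringHom_ext <;> intros <;> simp [θ]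
    exact fun r => DFunLike.congr_fun this r
  have hηC : ∀ r, η (Polynomial.C r) = MvPolynomial.map Polynomial.C r := fun r => by
    simp [η]
  have hθX : ∀ j, θ (X j) = Polynomial.C (X j) := fun j => by simp [θ]
  have hηX : η Polynomial.X = C Polynomial.X := by simp [η]
  have hθc : ∀ c, θ (C c) = c.map C := fun c => by simp [θ]
  set U := (axisKer φ i).map Polynomial.C ⊔ Ideal.span {familyEquation i D.ν D.q} with hU
  have hθU : ∀ g ∈ D.upperRayIdeal, θ g ∈ U := by
    intro g hg
    rw [← Ideal.mem_comap]
    revert g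
    change D.upperRayIdeal ≤ U.comap θ
    refine sup_le ?_ ?_
    · rw [hJ, Ideal.map_le_iff_le_comap]
      intro r hr
      rw [Ideal.mem_comap, Ideal.mem_comap, hθC]
      exact Ideal.mem_sup_left (Ideal.mem_map_of_mem _ hr)
    · rw [Ideal.span_singleton_le_iff_mem, Ideal.mem_comap]
      refine Ideal.mem_sup_right (Ideal.mem_span_singleton.mpr (dvd_of_eq ?_))
      simp only [familyEquation, map_sub, map_mul, map_pow, hθX, hθC, hθc, Polynomial.map_X]
  have hηU : ∀ g ∈ U, η g ∈ D.upperRayIdeal := by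
    intro g hg
    rw [← Ideal.mem_comap]
    revert g
    change U ≤ D.upperRayIdeal.comap η
    refine sup_le ?_ ?_
    · rw [Ideal.map_le_iff_le_comap]
      intro r hr
      rw [Ideal.mem_comap, Ideal.mem_comap, hηC]
      exact map_C_mem_upperRayIdeal hJ hr
    · rw [Ideal.span_singleton_le_iff_mem, Ideal.mem_comap]
      have := equation_mem_upperRayIdeal D
      simpa only [familyEquation, map_sub, map_mul, map_pow, hηX, hηC, map_X] using this
  rw [RayDecomposition.IsUpperRayDegeneration, IsDedekindDomain.flat_iff_torsion_eq_bot,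
    eq_bot_iff]
  rintro m ⟨⟨c, hc⟩, hcm⟩
  obtain ⟨g, rfl⟩ := Ideal.Quotient.mk_surjective m
  have h1 : C c * g ∈ D.upperRayIdeal := by
    rw [← Ideal.Quotient.eq_zero_iff_mem, ← hcm, ← smul_eq_C_mul]
    rfl
  have h2 := hθU _ h1
  rw [map_mul, hθc] at h2
  have h3 := hηU _ (h.mem_of_map_mul_mem (nonZeroDivisors.ne_zero hc) h2)
  rw [hηθ] at h3
  exact Ideal.Quotient.eq_zero_iff_mem.mpr h3

theorem exists_fibre_algEquiv (hJ : D.polyJ = axisKer φ i) {a : K} {C' : Type*}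
    [CommRing C'] [Algebra K C'] {χ : MvPolynomial (Fin n) K →ₐ[K] C'}
    (hχ : Function.Surjective χ)
    (hker : RingHom.ker χ = axisKer φ i ⊔ Ideal.span {rayEquation i D.ν D.q a}) :
    ∃ e : Fibre D.UpperRayFamily a ≃ₐ[K] C', ∀ j, e (fibreCoord D a j) = χ (X j) := by
  let ev : MvPolynomial (Fin n) (Polynomial K) →ₐ[K] MvPolynomial (Fin n) K :=
    MvPolynomial.mapAlgHom (Polynomial.aeval a)
  have hevC : ∀ r, ev (MvPolynomial.map Polynomial.C r) = r := by
    have : ev.toRingHom.comp (MvPolynomial.map Polynomial.C) = RingHom.id _ := by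
      apply MvPolynomial.ringHom_ext <;> intros <;> simp [ev]
    exact fun r => DFunLike.congr_fun this r
  have hevX : ∀ j, ev (X j) = X j := fun j => by simp [ev]
  have hevc : ∀ c, ev (C c) = C (c.eval a) := fun c => by simp [ev]
  have h1 : ∀ g ∈ D.upperRayIdeal, (χ.comp ev) g = 0 := by
    intro g hg
    have hle : D.upperRayIdeal ≤ (RingHom.ker χ).comap ev := by
      rw [hker]
      refine sup_le ?_ ?_
      · rw [hJ, Ideal.map_le_iff_le_comap]
        intro r hr
        rw [Ideal.mem_comap, Ideal.mem_comap, hevC]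
        exact Ideal.mem_sup_left hr
      · rw [Ideal.span_singleton_le_iff_mem, Ideal.mem_comap]
        refine Ideal.mem_sup_right (Ideal.mem_span_singleton.mpr (dvd_of_eq ?_))
        simp only [rayEquation, map_sub, map_mul, map_pow, hevX, hevC, hevc, Polynomial.eval_X]
    exact hle hg
  let ψ : D.UpperRayFamily →ₐ[K] C' := Ideal.Quotient.liftₐ D.upperRayIdeal (χ.comp ev) h1
  have hψ : ∀ g, ψ (Ideal.Quotient.mk _ g) = χ (ev g) := fun g => rfl
  have h2 : ∀ m ∈ Ideal.span
      {algebraMap (Polynomial K) D.UpperRayFamily (Polynomial.X - Polynomial.C a)}, ψ m = 0 := by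
    intro m hm
    obtain ⟨m, rfl⟩ := Ideal.mem_span_singleton'.mp hm
    have : ψ (algebraMap (Polynomial K) D.UpperRayFamily (Polynomial.X - Polynomial.C a)) = 0 := by
      change ψ (Ideal.Quotient.mk _ (C (Polynomial.X - Polynomial.C a))) = 0
      rw [hψ, hevc]
      simp
    rw [map_mul, this, mul_zero]
  let Ψ : Fibre D.UpperRayFamily a →ₐ[K] C' := Ideal.Quotient.liftₐ _ ψ h2
  have hΨ : ∀ g, Ψ (Ideal.Quotient.mk _ (Ideal.Quotient.mk _ g)) = χ (ev g) := fun g => rfl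
  have hsurj : Function.Surjective Ψ := by
    intro b
    obtain ⟨r, rfl⟩ := hχ b
    exact ⟨Ideal.Quotient.mk _ (Ideal.Quotient.mk _ (MvPolynomial.map Polynomial.C r)), by
      rw [hΨ, hevC]⟩
  have hinj : Function.Injective Ψ := by
    rw [injective_iff_map_eq_zero]
    intro m hm
    obtain ⟨m, rfl⟩ := Ideal.Quotient.mk_surjective m
    obtain ⟨g, rfl⟩ := Ideal.Quotient.mk_surjective m
    let κ : MvPolynomial (Fin n) (Polynomial K) →+* Fibre D.UpperRayFamily a :=
      (Ideal.Quotient.mk _).comp (Ideal.Quotient.mk _)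
    have hκt : κ (C Polynomial.X) = κ (C (Polynomial.C a)) := by
      rw [← sub_eq_zero, ← map_sub, ← map_sub]
      exact Ideal.Quotient.eq_zero_iff_mem.mpr (Ideal.mem_span_singleton_self _)
    -- In the fibre t equals a, so g agrees with its specialization; membership in the kernel of χ
    -- then lifts back to the family.
    have hκev : κ g = κ (MvPolynomial.map Polynomial.C (ev g)) := by
      have : κ = κ.comp ((MvPolynomial.map Polynomial.C).comp ev.toRingHom) := by
        apply MvPolynomial.ringHom_ext
        · intro c
          have : κ.comp C = (κ.comp ((MvPolynomial.map Polynomial.C).comp ev.toRingHom)).comp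
              C := by
            apply Polynomial.ringHom_ext
            · intro b
              simp [ev]
            · simpa [ev] using hκt
          exact DFunLike.congr_fun this c
        · intro j
          simp [ev]
      exact DFunLike.congr_fun this g
    change κ g = 0
    have hmem : ev g ∈ axisKer φ i ⊔ Ideal.span {rayEquation i D.ν D.q a} := by
      rw [← hker]
      exact hm
    have hκU : ∀ g ∈ D.upperRayIdeal, κ g = 0 := by
      intro g hg
      have : Ideal.Quotient.mk D.upperRayIdeal g = 0 := Ideal.Quotient.eq_zero_iff_mem.mpr hg
      simp [κ, this]
    rw [sup_comm, Ideal.mem_span_singleton_sup] at hmem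
    obtain ⟨b, j, hj, hbj⟩ := hmem
    have h3 : MvPolynomial.map Polynomial.C (rayEquation i D.ν D.q a) =
        X i ^ D.ν - C Polynomial.X * X i ^ (D.ν - 1) - MvPolynomial.map Polynomial.C D.q +
          (C Polynomial.X - C (Polynomial.C a)) * X i ^ (D.ν - 1) := by
      simp only [rayEquation, map_sub, map_mul, map_pow, map_X, map_C]
      ring
    have hκt0 : κ (C Polynomial.X - C (Polynomial.C a)) = 0 := by
      rw [map_sub κ]
      exact sub_eq_zero.mpr hκt
    have h4 : κ (MvPolynomial.map Polynomial.C (rayEquation i D.ν D.q a)) = 0 := by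
      rw [h3, map_add, hκU _ (equation_mem_upperRayIdeal D), map_mul, hκt0, zero_mul, add_zero]
    rw [hκev, ← hbj, map_add, map_add, map_mul, map_mul, h4, mul_zero, zero_add]
    exact hκU _ (map_C_mem_upperRayIdeal hJ hj)
  refine ⟨AlgEquiv.ofBijective Ψ ⟨hinj, hsurj⟩, fun j => ?_⟩
  change χ (ev (X j)) = _
  rw [hevX]

end Family

/-! ### Passage to power series and the ray decomposition -/

section PowerSeries

variable {K : Type u} [Field K] {A : Type v} [CommRing A] [Algebra K A] {n : ℕ}
  {φ : MvPolynomial (Fin n) K →ₐ[K] A} {i : Fin n} {s ν : ℕ} {q : MvPolynomial (Fin n) K}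

lemma rayProj_surjective : Function.Surjective (rayProj K i) := fun g =>
  ⟨MvPowerSeries.rename (⟨fun _ : Unit => i, Function.injective_of_subsingleton _⟩ : Unit ↪ Fin n)
    g, MvPowerSeries.killCompl_rename_app g⟩

lemma coeff_rayProj (f : MvPowerSeries (Fin n) K) (m : ℕ) :
    PowerSeries.coeff m (rayProj K i f) = MvPowerSeries.coeff (Finsupp.single i m) f := by
  rw [PowerSeries.coeff, rayProj, MvPowerSeries.coeff_killCompl, Finsupp.embDomain_single]
  rfl

lemma coe_X_pow_sub : (MvPowerSeries.X i ^ ν - (q : MvPowerSeries (Fin n) K)) =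
    ((X i ^ ν - q : MvPolynomial (Fin n) K) : MvPowerSeries (Fin n) K) := by
  have := (coeToMvPowerSeries.ringHom (σ := Fin n) (R := K)).map_sub (X i ^ ν) q
  simpa using this.symm

namespace IsRayPresentation

/-- The extension of a presentation to the power series ring. -/
def powerSeriesHom (h : IsRayPresentation φ i s ν q) : MvPowerSeries (Fin n) K →ₐ[K] A :=
  (Ideal.Quotient.liftₐ (idealOfVars (Fin n) K ^ (s + 1)) φ h.map_eq_zero_of_mem_pow).comp
    ((MvPowerSeries.truncTotalAlgHom (Fin n) K (s + 1)).restrictScalars K)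

lemma powerSeriesHom_apply (h : IsRayPresentation φ i s ν q) (f : MvPowerSeries (Fin n) K) :
    h.powerSeriesHom f = φ (MvPowerSeries.truncTotal (s + 1) f) := rfl

lemma powerSeriesHom_coe (h : IsRayPresentation φ i s ν q) (r : MvPolynomial (Fin n) K) :
    h.powerSeriesHom (r : MvPowerSeries (Fin n) K) = φ r := by
  have h1 : MvPowerSeries.truncTotal (s + 1) (r : MvPowerSeries (Fin n) K) - r ∈
      idealOfVars (Fin n) K ^ (s + 1) := by
    rw [mem_pow_idealOfVars_iff']
    intro x hx
    rw [coeff_sub, MvPowerSeries.coeff_truncTotal _ hx, coeff_coe, sub_self]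
  rw [powerSeriesHom_apply, ← sub_eq_zero, ← map_sub]
  exact h.map_eq_zero_of_mem_pow _ h1

lemma powerSeriesHom_surjective (h : IsRayPresentation φ i s ν q) :
    Function.Surjective h.powerSeriesHom := by
  intro a
  obtain ⟨r, rfl⟩ := h.surjective a
  exact ⟨r, h.powerSeriesHom_coe r⟩

/-- Only coefficients of degree below ν ≤ s + 1 matter, and truncation preserves them. -/
lemma X_pow_dvd_rayProj (h : IsRayPresentation φ i s ν q)
    {f : MvPowerSeries (Fin n) K} (hf : h.powerSeriesHom f = 0) :
    PowerSeries.X ^ ν ∣ rayProj K i f := by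
  rw [PowerSeries.X_pow_dvd_iff]
  intro m hm
  have hd := Polynomial.X_pow_dvd_iff.mp
    (h.dvd_of_map_eq_zero _ ((h.powerSeriesHom_apply f).symm.trans hf)) m hm
  rw [← Polynomial.coeff_coe, ← rayProj_coe, coeff_rayProj, coeff_coe,
    MvPowerSeries.coeff_truncTotal] at hd
  · rw [coeff_rayProj, hd]
  · rw [Finsupp.degree_single]
    have := h.le_succ
    omega

/-- The defining ideal of the algebra in the power series ring. -/
def powerSeriesIdeal (h : IsRayPresentation φ i s ν q) :
    Ideal (MvPowerSeries (Fin n) K) := RingHom.ker h.powerSeriesHom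

lemma X_pow_sub_mem (h : IsRayPresentation φ i s ν q) :
    MvPowerSeries.X i ^ ν - (q : MvPowerSeries (Fin n) K) ∈ h.powerSeriesIdeal := by
  rw [coe_X_pow_sub]
  change h.powerSeriesHom _ = 0
  rw [h.powerSeriesHom_coe, map_sub, h.map_q, sub_self]

lemma rayProj_X_pow_sub (h : IsRayPresentation φ i s ν q) :
    rayProj K i (MvPowerSeries.X i ^ ν - (q : MvPowerSeries (Fin n) K)) = PowerSeries.X ^ ν := by
  rw [coe_X_pow_sub, rayProj_coe, map_sub, h.axisProj_q, sub_zero, map_pow, axisProj_X_self,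
    Polynomial.coe_pow, Polynomial.coe_X]

/-- The ray decomposition given by a presentation. -/
def rayDecomposition (h : IsRayPresentation φ i s ν q) : RayDecomposition h.powerSeriesIdeal i where
  J := h.powerSeriesIdeal ⊓ rayIdeal K i
  q := q
  ν := ν
  J_le := le_rfl
  q_mem := by
    change rayProj K i _ = 0
    rw [rayProj_coe, h.axisProj_q, Polynomial.coe_zero]
  eq_sup := by
    apply le_antisymm
    · intro f hf
      obtain ⟨g, hg⟩ := h.X_pow_dvd_rayProj hf
      obtain ⟨g, rfl⟩ := rayProj_surjective (i := i) g
      rw [sup_comm, Ideal.mem_span_singleton_sup]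
      refine ⟨g, f - g * (MvPowerSeries.X i ^ ν - (q : MvPowerSeries (Fin n) K)), ⟨?_, ?_⟩,
        by ring⟩
      · exact sub_mem hf (Ideal.mul_mem_left _ _ h.X_pow_sub_mem)
      · change rayProj K i _ = 0
        rw [map_sub, map_mul, h.rayProj_X_pow_sub, hg]
        ring
    · refine sup_le inf_le_left ?_
      rw [Ideal.span_singleton_le_iff_mem]
      exact h.X_pow_sub_mem

lemma isRayOrder (h : IsRayPresentation φ i s ν q) : IsRayOrder h.powerSeriesIdeal i ν := by
  apply le_antisymm
  · rw [Ideal.map_le_iff_le_comap]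
    intro f hf
    rw [Ideal.mem_comap, Ideal.mem_span_singleton]
    exact h.X_pow_dvd_rayProj hf
  · rw [Ideal.span_singleton_le_iff_mem, ← h.rayProj_X_pow_sub]
    exact Ideal.mem_map_of_mem _ h.X_pow_sub_mem

lemma polyJ_rayDecomposition (h : IsRayPresentation φ i s ν q) :
    h.rayDecomposition.polyJ = axisKer φ i := by
  ext r
  rw [mem_axisKer, mem_axisIdeal, ← h.powerSeriesHom_coe, ← Polynomial.coe_eq_zero_iff,
    ← rayProj_coe]
  rfl

end IsRayPresentation

end PowerSeries

end RayDegeneration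

end

/-! ### Assembly of the theorem -/

theorem mainTheorem3 {K : Type u} [Field K] [IsAlgClosed K] [CharZero K]
    {A : Type v} [CommRing A] [IsLocalRing A] [Algebra K A] [Module.Finite K A]
    (n c s : ℕ)
    (hn : RayDegeneration.hilbertFunction K A 1 = n)
    (hs : RayDegeneration.IsSocleDegree A s)
    (htail : ∀ j, c < j → j ≤ s → RayDegeneration.hilbertFunction K A j = 1)
    (hs_pos : 1 ≤ s) (hsc : 2 * c ≤ s)
    (hexc : s = 2 → n = 1) :
    ∃ (I : Ideal (MvPowerSeries (Fin n) K)) (i : Fin n)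
      (D : RayDegeneration.RayDecomposition I i),
      Nonempty (A ≃ₐ[K] (MvPowerSeries (Fin n) K ⧸ I)) ∧
      D.J = I ⊓ RayDegeneration.rayIdeal K i ∧
      1 ≤ D.ν ∧ RayDegeneration.IsRayOrder I i D.ν ∧
      D.IsUpperRayDegeneration ∧
      Module.Finite (Polynomial K) D.UpperRayFamily ∧
      Nonempty (RayDegeneration.Fibre D.UpperRayFamily (0 : K) ≃ₐ[K] A) ∧
      ∀ a : K, a ≠ 0 →
        ∃ (B : Type u) (_ : CommRing B) (_ : IsLocalRing B) (_ : Algebra K B)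
          (_ : Module.Finite K B),
          RayDegeneration.IsSocleDegree B (s - 1) ∧
          (∀ j, j ≤ s - 1 →
            RayDegeneration.hilbertFunction K B j = RayDegeneration.hilbertFunction K A j) ∧
          ∃ e : RayDegeneration.Fibre D.UpperRayFamily a ≃ₐ[K] K × B,
            ∀ j : Fin n,
              (e (RayDegeneration.fibreCoord D a j)).1 = (if j = i then a else 0) ∧
              (e (RayDegeneration.fibreCoord D a j)).2 ∈ IsLocalRing.maximalIdeal B := by
  obtain ⟨i, φ, ν, q, hM, h⟩ :=
    RayDegeneration.exists_isRayPresentation (K := K) hn hs htail hs_pos hsc hexc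
  have hJ := h.polyJ_rayDecomposition
  refine ⟨h.powerSeriesIdeal, i, h.rayDecomposition,
    ⟨(Ideal.quotientKerAlgEquivOfSurjective h.powerSeriesHom_surjective).symm⟩, rfl,
    one_le_two.trans h.two_le, h.isRayOrder,
    RayDegeneration.flat_upperRayFamily (D := h.rayDecomposition) h hJ,
    RayDegeneration.finite_upperRayFamily (D := h.rayDecomposition) h hJ, ?_, ?_⟩
  · obtain ⟨e, -⟩ := RayDegeneration.exists_fibre_algEquiv (a := 0) hJ h.surjective
      (by rw [RayDegeneration.rayEquation_zero]; exact h.ker_eq)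
    exact ⟨e⟩
  · intro a ha
    obtain ⟨B, i1, i2, i3, i4, hB, hH, χ, hχ, hker, hcoord⟩ := h.exists_local_factor hM ha
    obtain ⟨e, he⟩ := RayDegeneration.exists_fibre_algEquiv (D := h.rayDecomposition) hJ hχ hker
    refine ⟨B, i1, i2, i3, i4, hB, hH, e, fun j => ?_⟩
    rw [he]
    exact hcoord j
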